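/- Let $D\subset\mathbb C$ be an unbounded domain whose boundary consists of (countably many) piecewise smooth curves and whose complement is unbounded, and let $f$ be a complex-valued function whose domain of definition contains $\overline D$. Suppose that $D$ is a logarithmic tract of $f$, that is, $f$ is holomorphic in $D$ and continuous in $\overline D$, and there exists $R>0$ such that $f:D\to\{w\in\mathbb C:|w|>R\}$ is a universal covering. Let $q$ be a real number and suppose that for each $\varepsilon>0$ there exists $r_\varepsilon>0$ such that \[ |f(z)|\le \exp\left(\exp\left((\log|z|)^{q+\varepsilon}\right)\right)\quad\text{for all } z\in D \text{ with } |z|\ge r_\varepsilon . \] (This can only happen if $q\ge 1$.) Let \[ I(f,D)=\{z\in D: f^n(z)\in D\text{ for all } n\in\mathbb N\text{ and } f^n(z)\to\infty\text{ as } n\to\infty\}. \] Then the Hausdorff dimension of $I(f,D)$ satisfies \[ \dim I(f,D)\ge 1+\frac1q . \] -/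

import Mathlib

open Set Filter Topology MeasureTheory

/-- The set `C` is a (regular) piecewise smooth curve in the plane: the image of a nondegenerate
interval `I` (of any kind, bounded or not) under a continuous map `γ` which, away from a locally
finite set `B` of break points, is continuously differentiable with nonvanishing derivative; at
the break points the one-sided derivatives have to exist, to be one-sided limits of the
derivative and to be nonzero. -/
def IsPiecewiseSmoothCurve (C : Set ℂ) : Prop :=
  ∃ (I : Set ℝ) (γ : ℝ → ℂ) (B : Set ℝ),
    I.OrdConnected ∧ I.Nontrivial ∧ ContinuousOn γ I ∧ γ '' I = C ∧
    (∀ a b : ℝ, (B ∩ Icc a b).Finite) ∧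
    (∀ a b : ℝ, a < b → Icc a b ⊆ I → Disjoint B (Ioo a b) →
      ContDiffOn ℝ 1 γ (Icc a b) ∧ ∀ t ∈ Icc a b, derivWithin γ (Icc a b) t ≠ 0)

/-- `f` is a universal covering of `D` onto `Ω`: it maps `D` onto `Ω`, the restriction `D → Ω` is
a covering map, and `D` is simply connected. -/
def IsUniversalCoveringOnto (f : ℂ → ℂ) (D Ω : Set ℂ) : Prop :=
  IsSimplyConnected D ∧ f '' D = Ω ∧
    ∃ h : MapsTo f D Ω, IsCoveringMap (h.restrict f D Ω)

/-- `D` is a logarithmic tract of `f`. Only the values of `f` on `closure D` matter; the values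
of the total function `f` elsewhere are irrelevant. -/
structure IsLogarithmicTract (f : ℂ → ℂ) (D : Set ℂ) : Prop where
  isOpen : IsOpen D
  isConnected : IsConnected D
  unbounded : ¬ Bornology.IsBounded D
  unbounded_compl : ¬ Bornology.IsBounded Dᶜ
  /-- The boundary consists of (countably many) piecewise smooth curves. -/
  frontier_eq : ∃ 𝒞 : Set (Set ℂ), 𝒞.Countable ∧ (∀ C ∈ 𝒞, IsPiecewiseSmoothCurve C) ∧
    frontier D = ⋃₀ 𝒞
  holomorphic : DifferentiableOn ℂ f D
  continuousOn : ContinuousOn f (closure D)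
  covering : ∃ R : ℝ, 0 < R ∧ IsUniversalCoveringOnto f D {w : ℂ | R < ‖w‖}

/-- The set `I(f, D)` of points of `D` whose orbit stays in `D` and tends to infinity. -/
def escapingSetIn (f : ℂ → ℂ) (D : Set ℂ) : Set ℂ :=
  {z | z ∈ D ∧ (∀ n : ℕ, f^[n] z ∈ D) ∧ Tendsto (fun n : ℕ => ‖f^[n] z‖) atTop atTop}

/-!
In logarithmic coordinates the inverse of `f` becomes a map `g` of a half-plane, the logarithm of a
conformal map, determined up to translations by `2πi`. Landau's estimate for `g` shows that
`Re g(x)` grows at most linearly in `log x`, and Koebe's distortion theorem controls `g` on discs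
around points of the real axis.

Fix `p > q` and `s > 1` with `p (s - 1) < 1`. The growth of `f` says that `log Re w ≤ (Re g(w)) ^ p`
far to the right. Hence, for a disc with a large centre `X` and radius `ρ` between constant
multiples of `X ^ (p (s - 1))` and `X`, the function `Re g(e ^ L)` runs through
`[X - ρ / 2, X + ρ / 2]` before `L = (2X) ^ p`, so at no less than half of about `(2X) ^ p`
equidistant levels its derivative is at least of order `ρ / (2X) ^ p`. The branches `g + 2πik` map
discs around the corresponding points into the given disc; the number of these images is at least
of order `ρ (2X) ^ p`, and they are well separated. The new discs are much further to the right
than `X`, so they can be used in turn in place of the given disc. The resulting tree consists of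
escaping orbits, and distributing mass uniformly gives dimension at least `s`, where `s` is
arbitrarily close to `1 + 1 / q`.
-/

/-! ### The mass distribution principle on trees of balls -/

/-- A tree of closed balls in a metric space: every node `σ` carries a ball, which contains the
images of the balls of its children `child σ i`, `i < num σ`, under the maps `map σ i`. The balls
of the children live in their own coordinates, and only their images are subsets of the ball of
the parent. -/
structure BallTree (S X : Type*) [PseudoMetricSpace X] [MeasurableSpace X] where
  center : S → X
  radius : S → ℝ
  num : S → ℕ
  child : S → ℕ → S
  map : S → ℕ → X → X
  radius_pos : ∀ σ, 0 < radius σ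
  two_le_num : ∀ σ, 2 ≤ num σ
  measurable_map : ∀ σ i, Measurable (map σ i)
  mapsTo : ∀ σ i, i < num σ →
    MapsTo (map σ i) (Metric.closedBall (center (child σ i)) (radius (child σ i)))
      (Metric.closedBall (center σ) (radius σ))
  lipschitz : ∀ σ i, i < num σ → ∃ L : NNReal, L * radius (child σ i) ≤ radius σ / 2 ∧
    LipschitzOnWith L (map σ i) (Metric.closedBall (center (child σ i)) (radius (child σ i)))

namespace BallTree

variable {S X : Type*} [MetricSpace X] [MeasurableSpace X] (T : BallTree S X)

/-- The ball of a node. -/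
def ball (σ : S) : Set X := Metric.closedBall (T.center σ) (T.radius σ)

/-- The points of the ball of `σ` having an infinite backward itinerary through the tree. -/
def limitSet (σ : S) : Set X :=
  {z | ∃ (τ : ℕ → S) (i : ℕ → ℕ) (w : ℕ → X), τ 0 = σ ∧ w 0 = z ∧
    ∀ n, i n < T.num (τ n) ∧ τ (n + 1) = T.child (τ n) (i n) ∧ w n ∈ T.ball (τ n) ∧
      w n = T.map (τ n) (i n) (w (n + 1))}

/-- The first digit of the address `ω ∈ [0, 1)` of a point below the node `σ`; the minimum makes
it the index of a child for every real `ω`. -/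
noncomputable def digit (σ : S) (ω : ℝ) : ℕ := min ⌊(T.num σ : ℝ) * ω⌋₊ (T.num σ - 1)

/-- The node reached by following the first digit. -/
noncomputable def next (σ : S) (ω : ℝ) : S := T.child σ (T.digit σ ω)

/-- The address that remains when the first digit is dropped. -/
noncomputable def shift (σ : S) (ω : ℝ) : ℝ := Int.fract ((T.num σ : ℝ) * ω)

/-- Approximations of the point with a given address. -/
noncomputable def approx : ℕ → S → ℝ → X
  | 0, σ, _ => T.center σ
  | n + 1, σ, ω => T.map σ (T.digit σ ω) (approx n (T.next σ ω) (T.shift σ ω))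

lemma digit_lt (σ : S) (ω : ℝ) : T.digit σ ω < T.num σ := by
  have := T.two_le_num σ
  unfold digit
  omega

lemma num_pos (σ : S) : (0 : ℝ) < T.num σ := by
  exact_mod_cast two_pos.trans_le (T.two_le_num σ)

lemma approx_mem (n : ℕ) (σ : S) (ω : ℝ) : T.approx n σ ω ∈ T.ball σ := by
  induction n generalizing σ ω with
  | zero => exact Metric.mem_closedBall_self (T.radius_pos σ).le
  | succ n ih => exact T.mapsTo σ _ (T.digit_lt σ ω) (ih _ _)

lemma measurable_approx (n : ℕ) (σ : S) : Measurable (T.approx n σ) := by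
  induction n generalizing σ with
  | zero => exact measurable_const
  | succ n ih =>
    have hd : Measurable (T.digit σ) :=
      (Nat.measurable_floor.comp (measurable_const.mul measurable_id)).min measurable_const
    have hs : Measurable (T.shift σ) :=
      measurable_fract.comp (measurable_const.mul measurable_id)
    have hF : Measurable fun x : ℕ × ℝ => T.map σ x.1 (T.approx n (T.child σ x.1) x.2) :=
      measurable_from_prod_countable_right fun i => (T.measurable_map σ i).comp (ih (T.child σ i))
    exact hF.comp (hd.prodMk hs)

lemma dist_approx_succ_le (n : ℕ) (σ : S) (ω : ℝ) :
    dist (T.approx (n + 1) σ ω) (T.approx n σ ω) ≤ T.radius σ * (1 / 2) ^ n := by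
  induction n generalizing σ ω with
  | zero => simpa [approx, ball] using T.approx_mem 1 σ ω
  | succ n ih =>
    obtain ⟨L, hL, hl⟩ := T.lipschitz σ _ (T.digit_lt σ ω)
    calc dist (T.approx (n + 2) σ ω) (T.approx (n + 1) σ ω)
        ≤ L * dist (T.approx (n + 1) (T.next σ ω) (T.shift σ ω))
            (T.approx n (T.next σ ω) (T.shift σ ω)) :=
          hl.dist_le_mul _ (T.approx_mem (n + 1) _ _) _ (T.approx_mem n _ _)
      _ ≤ L * (T.radius (T.next σ ω) * (1 / 2) ^ n) := by gcongr; exact ih _ _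
      _ = (L * T.radius (T.next σ ω)) * (1 / 2) ^ n := by ring
      _ ≤ (T.radius σ / 2) * (1 / 2) ^ n := by gcongr; exact hL
      _ = T.radius σ * (1 / 2) ^ (n + 1) := by ring

open Classical in
/-- The indices of the children of `σ` whose balls, mapped into the ball of `σ`, meet `A`. -/
noncomputable def hitChildren (σ : S) (A : Set X) : Finset ℕ :=
  {i ∈ Finset.range (T.num σ) | ∃ w ∈ T.ball (T.child σ i), T.map σ i w ∈ A}

/-- The data for the mass distribution principle on the limit set, in dimension `s`: `m σ i`
bounds the contraction of `map σ i` from below, and a set of diameter `r` below `σ` is to receive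
mass at most `r ^ s / h σ` when every node spreads its mass uniformly over its children. The bound
passes from the children to `σ` by `mass_le` if the set meets one of them only, and it holds by
`card_mul_le` if the set meets several. -/
structure IsMassDistribution (s : ℝ) (m : S → ℕ → ℝ) (h : S → ℝ) : Prop where
  weight_pos : ∀ σ, 0 < h σ
  contraction_pos : ∀ σ i, i < T.num σ → 0 < m σ i
  mul_dist_le : ∀ σ i, i < T.num σ → ∀ w ∈ T.ball (T.child σ i), ∀ w' ∈ T.ball (T.child σ i),
    m σ i * dist w w' ≤ dist (T.map σ i w) (T.map σ i w')
  mass_le : ∀ σ i, i < T.num σ → h σ ≤ T.num σ * m σ i ^ s * h (T.child σ i)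
  card_mul_le : ∀ σ (F : Finset ℕ) (r : ℝ), (∀ i ∈ F, i < T.num σ) → 2 ≤ F.card →
    (∀ i ∈ F, ∀ j ∈ F, ∃ w ∈ T.ball (T.child σ i), ∃ w' ∈ T.ball (T.child σ j),
      dist (T.map σ i w) (T.map σ j w') ≤ r) → F.card * h σ ≤ T.num σ * r ^ s

section

variable {T} {σ : S} {A : Set X} {ω : ℝ}

lemma digit_eq_floor (hω : ω ∈ Ico (0 : ℝ) 1) : T.digit σ ω = ⌊(T.num σ : ℝ) * ω⌋₊ := by
  have hlt : ⌊(T.num σ : ℝ) * ω⌋₊ < T.num σ := by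
    rw [Nat.floor_lt (mul_nonneg (T.num_pos σ).le hω.1)]
    exact mul_lt_of_lt_one_right (T.num_pos σ) hω.2
  unfold digit
  omega

lemma mul_sub_digit_mem_Ico (hω : ω ∈ Ico (0 : ℝ) 1) :
    T.num σ * ω - T.digit σ ω ∈ Ico (0 : ℝ) 1 := by
  rw [digit_eq_floor hω]
  have hfloor := Nat.floor_le (mul_nonneg (T.num_pos σ).le hω.1)
  have hlt := Nat.lt_floor_add_one ((T.num σ : ℝ) * ω)
  constructor <;> linarith

lemma shift_eq (hω : ω ∈ Ico (0 : ℝ) 1) : T.shift σ ω = T.num σ * ω - T.digit σ ω :=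
  Int.fract_eq_iff.2 ⟨(mul_sub_digit_mem_Ico hω).1, (mul_sub_digit_mem_Ico hω).2,
    T.digit σ ω, by push_cast; ring⟩

lemma mem_hitChildren {i : ℕ} :
    i ∈ T.hitChildren σ A ↔ i < T.num σ ∧ ∃ w ∈ T.ball (T.child σ i), T.map σ i w ∈ A := by
  simp [hitChildren]

namespace IsMassDistribution

variable {s : ℝ} {m : S → ℕ → ℝ} {h : S → ℝ}

lemma card_hitChildren_div_le (hT : T.IsMassDistribution s m h)
    (hcard : 2 ≤ (T.hitChildren σ A).card) {r : ℝ} (hA : ∀ x ∈ A, ∀ y ∈ A, dist x y ≤ r) :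
    (T.hitChildren σ A).card / T.num σ ≤ r ^ s / h σ := by
  have hmul := hT.card_mul_le σ _ r (fun i hi => (mem_hitChildren.1 hi).1) hcard
    fun i hi j hj => by
      obtain ⟨-, w, hw, hwA⟩ := mem_hitChildren.1 hi
      obtain ⟨-, w', hw', hwA'⟩ := mem_hitChildren.1 hj
      exact ⟨w, hw, w', hw', hA _ hwA _ hwA'⟩
  rw [div_le_div_iff₀ (T.num_pos σ) (hT.weight_pos σ)]
  linarith

lemma inv_num_mul_le (hT : T.IsMassDistribution s m h) {i : ℕ} (hi : i < T.num σ) {r : ℝ}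
    (hr : 0 ≤ r) : 1 / T.num σ * ((r / m σ i) ^ s / h (T.child σ i)) ≤ r ^ s / h σ := by
  have hN := T.num_pos σ
  have hc := hT.weight_pos (T.child σ i)
  have hm := Real.rpow_pos_of_pos (hT.contraction_pos σ i hi) s
  calc 1 / T.num σ * ((r / m σ i) ^ s / h (T.child σ i))
      = r ^ s / (T.num σ * m σ i ^ s * h (T.child σ i)) := by
        rw [Real.div_rpow hr (hT.contraction_pos σ i hi).le]
        field_simp
    _ ≤ r ^ s / h σ := div_le_div_of_nonneg_left (Real.rpow_nonneg hr s) (hT.weight_pos σ)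
        (hT.mass_le σ i hi)

end IsMassDistribution

end

variable [CompleteSpace X]

lemma exists_tendsto_approx (σ : S) (ω : ℝ) :
    ∃ z, Tendsto (fun n => T.approx n σ ω) atTop (𝓝 z) := by
  refine cauchySeq_tendsto_of_complete
    (cauchySeq_of_le_geometric (1 / 2) (T.radius σ) (by norm_num) fun n => ?_)
  rw [dist_comm]
  exact T.dist_approx_succ_le n σ ω

/-- The point of the limit set with a given address. -/
noncomputable def point (σ : S) (ω : ℝ) : X := (T.exists_tendsto_approx σ ω).choose

lemma tendsto_approx (σ : S) (ω : ℝ) :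
    Tendsto (fun n => T.approx n σ ω) atTop (𝓝 (T.point σ ω)) :=
  (T.exists_tendsto_approx σ ω).choose_spec

lemma point_mem (σ : S) (ω : ℝ) : T.point σ ω ∈ T.ball σ :=
  Metric.isClosed_closedBall.mem_of_tendsto (T.tendsto_approx σ ω)
    (Eventually.of_forall fun n => T.approx_mem n σ ω)

lemma point_eq (σ : S) (ω : ℝ) :
    T.point σ ω = T.map σ (T.digit σ ω) (T.point (T.next σ ω) (T.shift σ ω)) := by
  obtain ⟨L, -, hl⟩ := T.lipschitz σ _ (T.digit_lt σ ω)
  have hcont : ContinuousWithinAt (T.map σ (T.digit σ ω)) (T.ball (T.next σ ω))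
      (T.point (T.next σ ω) (T.shift σ ω)) := hl.continuousOn _ (T.point_mem _ _)
  refine tendsto_nhds_unique ((tendsto_add_atTop_iff_nat 1).2 (T.tendsto_approx σ ω)) ?_
  exact hcont.tendsto.comp (tendsto_nhdsWithin_iff.2
    ⟨T.tendsto_approx _ _, Eventually.of_forall fun n => T.approx_mem n _ _⟩)

lemma point_mem_limitSet (σ : S) (ω : ℝ) : T.point σ ω ∈ T.limitSet σ := by
  let x : ℕ → S × ℝ := fun n => (fun y => (T.next y.1 y.2, T.shift y.1 y.2))^[n] (σ, ω)
  have hx : ∀ n, x (n + 1) = (T.next (x n).1 (x n).2, T.shift (x n).1 (x n).2) :=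
    fun n => Function.iterate_succ_apply' _ _ _
  refine ⟨fun n => (x n).1, fun n => T.digit (x n).1 (x n).2,
    fun n => T.point (x n).1 (x n).2, rfl, rfl, fun n =>
      ⟨T.digit_lt _ _, ?_, T.point_mem _ _, ?_⟩⟩
  · simp only [hx]; rfl
  · simp only [hx]; exact T.point_eq _ _

/-- The addresses in `[0, 1)` of the points below `σ` that lie in `A`. -/
def addresses (σ : S) (A : Set X) : Set ℝ := {ω | ω ∈ Ico 0 1 ∧ T.point σ ω ∈ A}

variable {T} {σ : S} {A : Set X} {ω : ℝ}

lemma digit_mem_hitChildren (h : T.point σ ω ∈ A) : T.digit σ ω ∈ T.hitChildren σ A :=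
  mem_hitChildren.2
    ⟨T.digit_lt σ ω, _, T.point_mem (T.next σ ω) (T.shift σ ω), by rwa [← T.point_eq]⟩

lemma volume_addresses_le_card :
    volume (T.addresses σ A) ≤ ENNReal.ofReal ((T.hitChildren σ A).card / T.num σ) := by
  have hN := T.num_pos σ
  have hsub : T.addresses σ A ⊆
      ⋃ i ∈ T.hitChildren σ A, Ico ((i : ℝ) / T.num σ) ((i + 1 : ℝ) / T.num σ) := by
    rintro ω ⟨hω, hωA⟩
    refine mem_iUnion₂.2 ⟨T.digit σ ω, digit_mem_hitChildren hωA, ?_⟩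
    have := mul_sub_digit_mem_Ico (T := T) (σ := σ) hω
    rw [mem_Ico, div_le_iff₀ hN, lt_div_iff₀ hN]
    constructor <;> linarith [this.1, this.2]
  calc volume (T.addresses σ A)
      ≤ ∑ i ∈ T.hitChildren σ A, volume (Ico ((i : ℝ) / T.num σ) ((i + 1 : ℝ) / T.num σ)) :=
        (measure_mono hsub).trans (measure_biUnion_finset_le _ _)
    _ = ∑ i ∈ T.hitChildren σ A, ENNReal.ofReal (1 / T.num σ) :=
        Finset.sum_congr rfl fun i _ => by rw [Real.volume_Ico, ← sub_div, add_sub_cancel_left]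
    _ = ENNReal.ofReal ((T.hitChildren σ A).card / T.num σ) := by
        rw [Finset.sum_const, nsmul_eq_mul, ← ENNReal.ofReal_natCast,
          ← ENNReal.ofReal_mul (by positivity), mul_one_div]

lemma addresses_eq_empty (h : T.hitChildren σ A = ∅) : T.addresses σ A = ∅ :=
  eq_empty_of_forall_notMem fun ω hω => by simpa [h] using digit_mem_hitChildren hω.2

lemma volume_addresses_le_of_hitChildren_eq_singleton {i : ℕ} (h : T.hitChildren σ A = {i}) :
    volume (T.addresses σ A) ≤ ENNReal.ofReal (1 / T.num σ) *
      volume (T.addresses (T.child σ i) (T.map σ i ⁻¹' A ∩ T.ball (T.child σ i))) := by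
  have hN := T.num_pos σ
  have hsub : T.addresses σ A ⊆ (fun ω => (T.num σ : ℝ) * ω) ⁻¹' ((fun ω => ω - (i : ℝ)) ⁻¹'
      T.addresses (T.child σ i) (T.map σ i ⁻¹' A ∩ T.ball (T.child σ i))) := by
    rintro ω ⟨hω, hωA⟩
    have hdigit : T.digit σ ω = i := by simpa [h] using digit_mem_hitChildren hωA
    have hpoint := T.point_eq σ ω
    have hmem := T.point_mem (T.next σ ω) (T.shift σ ω)
    have hIco := mul_sub_digit_mem_Ico (T := T) (σ := σ) hω
    rw [shift_eq hω, next, hdigit] at hpoint hmem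
    rw [hdigit] at hIco
    exact ⟨hIco, by rw [mem_preimage, ← hpoint]; exact hωA, hmem⟩
  refine (measure_mono hsub).trans_eq ?_
  rw [Real.volume_preimage_mul_left hN.ne', abs_of_pos (inv_pos.2 hN), one_div]
  simp_rw [sub_eq_add_neg]
  rw [measure_preimage_add_right]

namespace IsMassDistribution

variable {s : ℝ} {m : S → ℕ → ℝ} {h : S → ℝ}

lemma volume_addresses_le_add (hT : T.IsMassDistribution s m h) (n : ℕ) (σ : S) {A : Set X}
    {r : ℝ} (hr : 0 ≤ r) (hA : ∀ x ∈ A, ∀ y ∈ A, dist x y ≤ r) :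
    volume (T.addresses σ A) ≤ ENNReal.ofReal (r ^ s / h σ + (1 / 2) ^ n) := by
  have hbound : 0 ≤ r ^ s / h σ := div_nonneg (Real.rpow_nonneg hr s) (hT.weight_pos σ).le
  induction n generalizing σ A r with
  | zero =>
    calc volume (T.addresses σ A) ≤ volume (Ico (0 : ℝ) 1) := measure_mono fun ω hω => hω.1
      _ = ENNReal.ofReal 1 := by simp
      _ ≤ _ := ENNReal.ofReal_le_ofReal (by simpa using hbound)
  | succ n ih =>
    rcases lt_or_ge 1 (T.hitChildren σ A).card with hcard | hcard
    · refine volume_addresses_le_card.trans (ENNReal.ofReal_le_ofReal ?_)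
      exact (hT.card_hitChildren_div_le hcard hA).trans (le_add_of_nonneg_right (by positivity))
    rcases Finset.card_le_one_iff_subset_singleton.1 hcard with ⟨i, hsub⟩
    rcases Finset.subset_singleton_iff.1 hsub with hempty | hi
    · simp [addresses_eq_empty hempty]
    have hiN : i < T.num σ := (mem_hitChildren.1 (hi ▸ Finset.mem_singleton_self i)).1
    have hm := hT.contraction_pos σ i hiN
    have hdist : ∀ x ∈ T.map σ i ⁻¹' A ∩ T.ball (T.child σ i),
        ∀ y ∈ T.map σ i ⁻¹' A ∩ T.ball (T.child σ i), dist x y ≤ r / m σ i := fun x hx y hy => by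
      rw [le_div_iff₀ hm, mul_comm]
      exact (hT.mul_dist_le σ i hiN x hx.2 y hy.2).trans (hA _ hx.1 _ hy.1)
    have hrm : 0 ≤ r / m σ i := div_nonneg hr hm.le
    have hinv : 1 / (T.num σ : ℝ) ≤ 1 / 2 :=
      one_div_le_one_div_of_le two_pos (by exact_mod_cast T.two_le_num σ)
    calc volume (T.addresses σ A)
        ≤ ENNReal.ofReal (1 / T.num σ) *
          ENNReal.ofReal ((r / m σ i) ^ s / h (T.child σ i) + (1 / 2) ^ n) :=
          (volume_addresses_le_of_hitChildren_eq_singleton hi).trans <| mul_le_mul_right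
            (ih _ hrm hdist (div_nonneg (Real.rpow_nonneg hrm s) (hT.weight_pos _).le)) _
      _ = ENNReal.ofReal (1 / T.num σ * ((r / m σ i) ^ s / h (T.child σ i)) +
            1 / T.num σ * (1 / 2) ^ n) := by rw [← ENNReal.ofReal_mul (by positivity), mul_add]
      _ ≤ ENNReal.ofReal (r ^ s / h σ + (1 / 2) ^ (n + 1)) := by
          rw [pow_succ']
          gcongr
          exact hT.inv_num_mul_le hiN hr

lemma volume_addresses_le (hT : T.IsMassDistribution s m h) {r : ℝ} (hr : 0 ≤ r)
    (hA : ∀ x ∈ A, ∀ y ∈ A, dist x y ≤ r) :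
    volume (T.addresses σ A) ≤ ENNReal.ofReal (r ^ s / h σ) := by
  have hlim : Tendsto (fun n : ℕ => ENNReal.ofReal (r ^ s / h σ + (1 / 2) ^ n)) atTop
      (𝓝 (ENNReal.ofReal (r ^ s / h σ + 0))) :=
    ENNReal.tendsto_ofReal (tendsto_const_nhds.add
      (tendsto_pow_atTop_nhds_zero_of_lt_one (by norm_num) (by norm_num)))
  rw [add_zero] at hlim
  exact ge_of_tendsto' hlim fun n => hT.volume_addresses_le_add n σ hr hA

end IsMassDistribution

variable [BorelSpace X]

variable (T σ) in
lemma measurable_point : Measurable (T.point σ) :=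
  measurable_of_tendsto_metrizable (fun n => T.measurable_approx n σ)
    (tendsto_pi_nhds.2 fun ω => T.tendsto_approx σ ω)

variable (T σ) in
/-- The distribution of the point below `σ` whose address is chosen uniformly in `[0, 1)`. -/
noncomputable def pointMeasure : Measure X := (volume.restrict (Ico (0 : ℝ) 1)).map (T.point σ)

lemma pointMeasure_apply (hA : MeasurableSet A) :
    T.pointMeasure σ A = volume (T.addresses σ A) := by
  rw [pointMeasure, Measure.map_apply (T.measurable_point σ) hA,
    Measure.restrict_apply (T.measurable_point σ hA), inter_comm]
  rfl

lemma pointMeasure_limitSet_ne_zero : T.pointMeasure σ (T.limitSet σ) ≠ 0 := by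
  have hle := Measure.le_map_apply (μ := volume.restrict (Ico (0 : ℝ) 1))
    (T.measurable_point σ).aemeasurable (T.limitSet σ)
  have huniv : T.point σ ⁻¹' T.limitSet σ = univ :=
    eq_univ_of_forall fun ω => T.point_mem_limitSet σ ω
  refine ((zero_lt_one' ENNReal).trans_le ?_).ne'
  simpa [pointMeasure, huniv] using hle

namespace IsMassDistribution

variable {s : ℝ} {m : S → ℕ → ℝ} {h : S → ℝ}

lemma smul_pointMeasure_le_hausdorffMeasure (hT : T.IsMassDistribution s m h) (hs : 0 < s)
    (σ : S) : ENNReal.ofReal (h σ) • T.pointMeasure σ ≤ Measure.hausdorffMeasure s := by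
  have hh := hT.weight_pos σ
  refine Measure.le_hausdorffMeasure s _ 1 one_pos fun A hA => ?_
  have hb : Bornology.IsBounded (closure A) := Metric.isBounded_iff_ediam_ne_top.2
    (ne_top_of_le_ne_top ENNReal.one_ne_top (by rwa [Metric.ediam_closure]))
  rw [Measure.smul_apply, smul_eq_mul]
  calc ENNReal.ofReal (h σ) * T.pointMeasure σ A
      ≤ ENNReal.ofReal (h σ) * T.pointMeasure σ (closure A) := by gcongr; exact subset_closure
    _ ≤ ENNReal.ofReal (h σ) * ENNReal.ofReal (Metric.diam (closure A) ^ s / h σ) := by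
        rw [pointMeasure_apply isClosed_closure.measurableSet]
        gcongr
        exact hT.volume_addresses_le Metric.diam_nonneg fun x hx y hy =>
          Metric.dist_le_diam_of_mem hb hx hy
    _ = ENNReal.ofReal (Metric.diam (closure A) ^ s) := by
        rw [← ENNReal.ofReal_mul hh.le, mul_div_cancel₀ _ hh.ne']
    _ = Metric.ediam A ^ s := by
        rw [← ENNReal.ofReal_rpow_of_nonneg Metric.diam_nonneg hs.le, Metric.diam,
          ENNReal.ofReal_toReal hb.ediam_ne_top, Metric.ediam_closure]

theorem le_dimH_limitSet (hT : T.IsMassDistribution s m h) (hs : 0 < s) (σ : S) :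
    ENNReal.ofReal s ≤ dimH (T.limitSet σ) := by
  have hpos : 0 < (ENNReal.ofReal (h σ) • T.pointMeasure σ) (T.limitSet σ) :=
    ENNReal.mul_pos (by simpa using hT.weight_pos σ) pointMeasure_limitSet_ne_zero
  refine le_dimH_of_hausdorffMeasure_ne_zero (d := s.toNNReal) ?_
  rw [Real.coe_toNNReal s hs.le]
  exact (hpos.trans_le (hT.smul_pointMeasure_le_hausdorffMeasure hs σ _)).ne'

end IsMassDistribution

end BallTree

/-! ### Continuous inverse branches, Landau's estimate and Koebe's distortion theorem -/

lemma differentiableAt_of_comp_eventuallyEq {f ψ h : ℂ → ℂ} {w : ℂ} (hf : AnalyticAt ℂ f (ψ w))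
    (hf' : deriv f (ψ w) ≠ 0) (hψ : ContinuousAt ψ w) (hfψ : f ∘ ψ =ᶠ[𝓝 w] h)
    (hh : DifferentiableAt ℂ h w) : DifferentiableAt ℂ ψ w := by
  have hs : HasStrictDerivAt f (deriv f (ψ w)) (ψ w) := hf.hasStrictDerivAt
  have hinv : HasDerivAt (hs.localInverse f _ _ hf') (deriv f (ψ w))⁻¹ (f (ψ w)) :=
    (hs.to_localInverse hf').hasDerivAt
  have hleft : ∀ᶠ x in 𝓝 (ψ w), hs.localInverse f _ _ hf' (f x) = x :=
    hs.hasStrictFDerivAt_equiv hf' |>.eventually_left_inverse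
  have heq : ψ =ᶠ[𝓝 w] hs.localInverse f _ _ hf' ∘ h := by
    filter_upwards [hψ.eventually hleft, hfψ] with x hx hx'
    rw [Function.comp_apply, ← hx', Function.comp_apply, hx]
  rw [show f (ψ w) = h w from hfψ.self_of_nhds] at hinv
  exact (hinv.differentiableAt.comp w hh).congr_of_eventuallyEq heq

lemma eventually_deriv_ne_zero_of_comp_eventuallyEq {f ψ h : ℂ → ℂ} {w : ℂ}
    (hf : AnalyticAt ℂ f (ψ w)) (hψ : ContinuousAt ψ w) (hfψ : f ∘ ψ =ᶠ[𝓝 w] h)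
    (hh : deriv h w ≠ 0) : ∀ᶠ z in 𝓝[≠] ψ w, deriv f z ≠ 0 := by
  refine hf.deriv.eventually_eq_zero_or_eventually_ne_zero.resolve_left fun hzero => hh ?_
  obtain ⟨ε, hε, hball⟩ := Metric.eventually_nhds_iff_ball.1
    (hzero.and hf.eventually_analyticAt)
  have hconst : ∀ z ∈ Metric.ball (ψ w) ε, f z = f (ψ w) := fun z hz =>
    Metric.isOpen_ball.is_const_of_deriv_eq_zero (convex_ball _ _).isPreconnected
      (fun x hx => (hball x hx).2.differentiableAt.differentiableWithinAt)
      (fun x hx => (hball x hx).1) hz (Metric.mem_ball_self hε)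
  have heq : h =ᶠ[𝓝 w] fun _ => f (ψ w) := by
    filter_upwards [hψ.eventually (Metric.ball_mem_nhds _ hε), hfψ] with x hx hx'
    rw [← hx', Function.comp_apply, hconst _ hx]
  rw [heq.deriv_eq, deriv_const]

lemma differentiableOn_of_comp_eqOn {f ψ h : ℂ → ℂ} {U V : Set ℂ} (hU : IsOpen U) (hV : IsOpen V)
    (hψ : ContinuousOn ψ U) (hinj : InjOn ψ U) (hmaps : MapsTo ψ U V)
    (hf : DifferentiableOn ℂ f V) (hfψ : EqOn (f ∘ ψ) h U) (hh : DifferentiableOn ℂ h U)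
    (hh' : ∀ w ∈ U, deriv h w ≠ 0) : DifferentiableOn ℂ ψ U := by
  have hfa : ∀ w ∈ U, AnalyticAt ℂ f (ψ w) := fun w hw => hf.analyticAt (hV.mem_nhds (hmaps hw))
  have hcont : ∀ w ∈ U, ContinuousAt ψ w := fun w hw => hψ.continuousAt (hU.mem_nhds hw)
  have heq : ∀ w ∈ U, f ∘ ψ =ᶠ[𝓝 w] h := fun w hw => hfψ.eventuallyEq_of_mem (hU.mem_nhds hw)
  intro w hw
  refine (Complex.analyticAt_of_differentiable_on_punctured_nhds_of_continuousAt ?_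
    (hcont w hw)).differentiableAt.differentiableWithinAt
  have hpunctured : Tendsto ψ (𝓝[≠] w) (𝓝[≠] (ψ w)) := by
    refine tendsto_nhdsWithin_iff.2 ⟨(hcont w hw).tendsto.mono_left nhdsWithin_le_nhds, ?_⟩
    filter_upwards [self_mem_nhdsWithin, mem_nhdsWithin_of_mem_nhds (hU.mem_nhds hw)]
      with x hx hxU hxw using hx (hinj hxU hw hxw)
  filter_upwards [hpunctured.eventually
      (eventually_deriv_ne_zero_of_comp_eventuallyEq (hfa w hw) (hcont w hw) (heq w hw) (hh' w hw)),
    mem_nhdsWithin_of_mem_nhds (hU.mem_nhds hw)] with x hx hxU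
  exact differentiableAt_of_comp_eventuallyEq (hfa x hxU) hx (hcont x hxU) (heq x hxU)
    (hh.differentiableAt (hU.mem_nhds hxU))

lemma differentiableOn_of_exp_comp_eqOn {ψ h : ℂ → ℂ} {U : Set ℂ} (hU : IsOpen U)
    (hψ : ContinuousOn ψ U) (heq : EqOn (Complex.exp ∘ ψ) h U) (hh : DifferentiableOn ℂ h U) :
    DifferentiableOn ℂ ψ U := fun _ hw =>
  (differentiableAt_of_comp_eventuallyEq analyticAt_cexp (by simp [Complex.exp_ne_zero])
    (hψ.continuousAt (hU.mem_nhds hw)) (heq.eventuallyEq_of_mem (hU.mem_nhds hw))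
    (hh.differentiableAt (hU.mem_nhds hw))).differentiableWithinAt

lemma exists_differentiableOn_log {G : ℂ → ℂ} {U : Set ℂ} (hU : IsOpen U)
    (hsc : IsSimplyConnected U) (hG : DifferentiableOn ℂ G U) (hne : ∀ w ∈ U, G w ≠ 0) :
    ∃ g : ℂ → ℂ, DifferentiableOn ℂ g U ∧ EqOn (Complex.exp ∘ g) G U := by
  obtain ⟨g, hgc, hg⟩ := Complex.exists_continuousOn_eqOn_exp_comp hsc hU hG.continuousOn
    (by rintro ⟨w, hw, hw0⟩; exact hne w hw hw0)
  exact ⟨g, differentiableOn_of_exp_comp_eqOn hU hgc hg hG, hg⟩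

lemma isSimplyConnected_of_convex {E : Type*} [AddCommGroup E] [Module ℝ E] [TopologicalSpace E]
    [ContinuousAdd E] [ContinuousSMul ℝ E] {U : Set E} (hU : Convex ℝ U) (hne : U.Nonempty) :
    IsSimplyConnected U :=
  have : ContractibleSpace U := hU.contractibleSpace hne
  (inferInstance : SimplyConnectedSpace U)

lemma deriv_eq_mul_deriv_of_exp_comp_eventuallyEq {f g : ℂ → ℂ} {a : ℂ}
    (hg : DifferentiableAt ℂ g a) (h : Complex.exp ∘ g =ᶠ[𝓝 a] f) :
    deriv f a = f a * deriv g a := by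
  rw [← h.deriv_eq, ← h.self_of_nhds]
  exact hg.hasDerivAt.cexp.deriv

lemma norm_sub_sub_mul_le_of_norm_deriv_sub_le {f : ℂ → ℂ} {U : Set ℂ} {c : ℂ} {ε : ℝ}
    (hU : Convex ℝ U) (hf : ∀ x ∈ U, DifferentiableAt ℂ f x)
    (hd : ∀ x ∈ U, ‖deriv f x - c‖ ≤ ε) {z w : ℂ} (hz : z ∈ U) (hw : w ∈ U) :
    ‖f z - f w - c * (z - w)‖ ≤ ε * ‖z - w‖ := by
  have hderiv : ∀ x ∈ U, HasDerivAt (fun x => f x - c * x) (deriv f x - c) x := fun x hx => by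
    simpa using (hf x hx).hasDerivAt.fun_sub ((hasDerivAt_id x).const_mul c)
  have := hU.norm_image_sub_le_of_norm_deriv_le (fun x hx => (hderiv x hx).differentiableAt)
    (fun x hx => (hderiv x hx).deriv ▸ hd x hx) hw hz
  rwa [show f z - f w - c * (z - w) = f z - c * z - (f w - c * w) by ring]

lemma norm_deriv_sub_le_of_norm_deriv_le {f : ℂ → ℂ} {a z : ℂ} {r M : ℝ}
    (hf : DifferentiableOn ℂ f (Metric.ball a r)) (hM : ∀ z ∈ Metric.ball a r, ‖deriv f z‖ ≤ M)
    (hz : z ∈ Metric.ball a r) : ‖deriv f z - deriv f a‖ ≤ 2 * M / r * ‖z - a‖ := by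
  have ha : a ∈ Metric.ball a r := Metric.mem_ball_self (dist_nonneg.trans_lt hz)
  have := Complex.dist_le_div_mul_dist_of_mapsTo_ball (hf.deriv Metric.isOpen_ball) (R₂ := 2 * M)
    (fun x hx => mem_closedBall_iff_norm.2 <| (norm_sub_le _ _).trans <| by
      linarith [hM x hx, hM a ha]) hz
  rwa [dist_eq_norm, dist_eq_norm] at this

lemma ball_subset_image_closedBall_of_norm_deriv_sub_le {f : ℂ → ℂ} {a : ℂ} {r ε : ℝ}
    (hr : 0 < r) (hf : ∀ z ∈ Metric.closedBall a r, DifferentiableAt ℂ f z)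
    (hd : ∀ z ∈ Metric.closedBall a r, ‖deriv f z - deriv f a‖ ≤ ε) (hε : ε < ‖deriv f a‖) :
    Metric.ball (f a) ((‖deriv f a‖ - ε) * r / 2) ⊆ f '' Metric.closedBall a r := by
  have ha : a ∈ Metric.closedBall a r := Metric.mem_closedBall_self hr.le
  have hε0 : 0 ≤ ε := (norm_nonneg _).trans (hd a ha)
  refine DiffContOnCl.ball_subset_image_closedBall (DifferentiableOn.diffContOnCl ?_) hr
    (fun z hz => ?_) ?_
  · rw [closure_ball a hr.ne']
    exact fun z hz => (hf z hz).differentiableWithinAt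
  · have haffine := norm_sub_sub_mul_le_of_norm_deriv_sub_le (convex_closedBall a r) hf hd
      (Metric.sphere_subset_closedBall hz) ha
    have hsub := norm_sub_norm_le (deriv f a * (z - a)) (f z - f a)
    rw [norm_sub_rev _ (f z - f a), norm_mul] at hsub
    rw [mem_sphere_iff_norm.1 hz] at haffine hsub
    linarith
  · exact ((hf a ha).hasDerivAt.eventually_ne
      (norm_pos_iff.1 (hε0.trans_lt hε))).frequently.filter_mono nhdsWithin_le_nhds

lemma exists_ball_norm_le_two_mul {X E : Type*} [PseudoMetricSpace X] [ProperSpace X]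
    [SeminormedAddCommGroup E] {φ : X → E} {a : X} {r : ℝ} (hr : 0 < r)
    (hφ : ContinuousOn φ (Metric.closedBall a r)) (hφa : 0 < ‖φ a‖) :
    ∃ b t, 0 < t ∧ Metric.ball b t ⊆ Metric.ball a r ∧ r * ‖φ a‖ ≤ 2 * t * ‖φ b‖ ∧
      ∀ z ∈ Metric.ball b t, ‖φ z‖ ≤ 2 * ‖φ b‖ := by
  obtain ⟨b, -, hmax⟩ := (isCompact_closedBall a r).exists_isMaxOn
    ⟨a, Metric.mem_closedBall_self hr.le⟩ (f := fun z => ‖φ z‖ * (r - dist z a))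
    (hφ.norm.mul (by fun_prop))
  rw [isMaxOn_iff] at hmax
  have hba := hmax a (Metric.mem_closedBall_self hr.le)
  rw [dist_self, sub_zero] at hba
  have ht : 0 < r - dist b a := by
    by_contra! h
    exact (mul_pos hφa hr).not_ge (hba.trans (mul_nonpos_of_nonneg_of_nonpos (norm_nonneg _) h))
  refine ⟨b, (r - dist b a) / 2, half_pos ht, Metric.ball_subset_ball' (by linarith),
    by linarith, fun z hz => ?_⟩
  have hza : dist z a ≤ r - (r - dist b a) / 2 := by
    linarith [dist_triangle z b a, Metric.mem_ball.1 hz]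
  have hzmax := hmax z (Metric.mem_closedBall.2 (by linarith))
  refine le_of_mul_le_mul_right ?_ (half_pos ht)
  calc ‖φ z‖ * ((r - dist b a) / 2) ≤ ‖φ z‖ * (r - dist z a) := by gcongr; linarith
    _ ≤ 2 * ‖φ b‖ * ((r - dist b a) / 2) := by linarith

lemma exists_ball_subset_image_ball {f : ℂ → ℂ} {a : ℂ} {r : ℝ} (hr : 0 < r)
    (hf : DifferentiableOn ℂ f (Metric.ball a r)) :
    ∃ w, Metric.ball w (r * ‖deriv f a‖ / 128) ⊆ f '' Metric.ball a r := by
  rcases (norm_nonneg (deriv f a)).eq_or_lt with hfa | hfa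
  · exact ⟨0, by simp [← hfa]⟩
  obtain ⟨b, t, ht, hsub, hab, hb⟩ := exists_ball_norm_le_two_mul (half_pos hr)
    ((hf.deriv Metric.isOpen_ball).continuousOn.mono
      (Metric.closedBall_subset_ball (half_lt_self hr))) hfa
  replace hsub := hsub.trans (Metric.ball_subset_ball (half_le_self hr.le))
  have hfb : 0 < ‖deriv f b‖ := by
    by_contra! h
    nlinarith [mul_pos hr hfa]
  have hclosed : Metric.closedBall b (t / 8) ⊆ Metric.ball b t :=
    Metric.closedBall_subset_ball (by linarith)
  have hderiv : ∀ z ∈ Metric.closedBall b (t / 8), ‖deriv f z - deriv f b‖ ≤ ‖deriv f b‖ / 2 := by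
    intro z hz
    calc ‖deriv f z - deriv f b‖ ≤ 2 * (2 * ‖deriv f b‖) / t * ‖z - b‖ :=
          norm_deriv_sub_le_of_norm_deriv_le (hf.mono hsub) hb (hclosed hz)
      _ ≤ 2 * (2 * ‖deriv f b‖) / t * (t / 8) := by gcongr; exact mem_closedBall_iff_norm.1 hz
      _ = ‖deriv f b‖ / 2 := by field_simp; norm_num
  refine ⟨f b, (Metric.ball_subset_ball ?_).trans
    ((ball_subset_image_closedBall_of_norm_deriv_sub_le (by positivity)
      (fun z hz => hf.differentiableAt (Metric.isOpen_ball.mem_nhds (hsub (hclosed hz)))) hderiv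
      (half_lt_self hfb)).trans (image_mono (hclosed.trans hsub)))⟩
  linarith

lemma norm_deriv_mul_le_of_exp_injOn {g : ℂ → ℂ} {a : ℂ} {r : ℝ} (hr : 0 < r)
    (hg : DifferentiableOn ℂ g (Metric.ball a r))
    (hinj : InjOn (fun w => Complex.exp (g w)) (Metric.ball a r)) :
    ‖deriv g a‖ * r ≤ 1000 := by
  by_contra! h
  obtain ⟨w, hw⟩ := exists_ball_subset_image_ball hr hg
  have hR : 7 < r * ‖deriv g a‖ / 128 := by linarith
  have hmem : w + 2 * Real.pi * Complex.I ∈ Metric.ball w (r * ‖deriv g a‖ / 128) := by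
    rw [mem_ball_iff_norm, add_sub_cancel_left]
    simp only [norm_mul, Complex.norm_I, mul_one, Complex.norm_ofNat, Complex.norm_real,
      Real.norm_eq_abs, abs_of_pos Real.pi_pos]
    linarith [Real.pi_lt_d2, hR]
  obtain ⟨z₁, hz₁, hgz₁⟩ := hw (Metric.mem_ball_self (by linarith))
  obtain ⟨z₂, hz₂, hgz₂⟩ := hw hmem
  have heq : z₁ = z₂ := hinj hz₁ hz₂ (by simp only [hgz₁, hgz₂, Complex.exp_periodic w])
  rw [heq, hgz₂] at hgz₁
  simp [Real.pi_ne_zero] at hgz₁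

lemma norm_deriv_mul_le_of_notMem_image {f : ℂ → ℂ} {a v : ℂ} {r : ℝ} (hr : 0 < r)
    (hf : DifferentiableOn ℂ f (Metric.ball a r)) (hinj : InjOn f (Metric.ball a r))
    (hv : v ∉ f '' Metric.ball a r) : ‖deriv f a‖ * r ≤ 1000 * ‖f a - v‖ := by
  have ha : a ∈ Metric.ball a r := Metric.mem_ball_self hr
  have hnhds := Metric.isOpen_ball.mem_nhds ha
  obtain ⟨g, hg, hgf⟩ := exists_differentiableOn_log Metric.isOpen_ball
    (isSimplyConnected_of_convex (convex_ball a r) ⟨a, ha⟩) (hf.sub_const v)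
    fun w hw h => hv ⟨w, hw, sub_eq_zero.1 h⟩
  have hderiv : deriv f a = (f a - v) * deriv g a := by
    rw [← deriv_sub_const_fun v]
    exact deriv_eq_mul_deriv_of_exp_comp_eventuallyEq (hg.differentiableAt hnhds)
      (hgf.eventuallyEq_of_mem hnhds)
  have hbound := norm_deriv_mul_le_of_exp_injOn hr hg fun x hx y hy hxy =>
    hinj hx hy (sub_left_injective ((hgf hx).symm.trans (hxy.trans (hgf hy))))
  rw [hderiv, norm_mul, mul_assoc, mul_comm (1000 : ℝ)]
  gcongr

lemma exists_mem_sphere_norm_sub_le {f : ℂ → ℂ} {a : ℂ} {r t : ℝ} (ht : 0 < t) (htr : t < r)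
    (hf : DifferentiableOn ℂ f (Metric.ball a r)) (hinj : InjOn f (Metric.ball a r))
    (hfa : deriv f a ≠ 0) : ∃ b ∈ Metric.sphere a t, ‖f b - f a‖ ≤ t * ‖deriv f a‖ := by
  have ha : a ∈ Metric.ball a r := Metric.mem_ball_self (ht.trans htr)
  have hsub : Metric.closedBall a t ⊆ Metric.ball a r := Metric.closedBall_subset_ball htr
  have hne : ∀ z ∈ Metric.ball a r, dslope f a z ≠ 0 := by
    intro z hz
    rcases eq_or_ne z a with rfl | hza
    · rwa [dslope_same]
    rw [dslope_of_ne _ hza, slope_def_field]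
    exact div_ne_zero (sub_ne_zero.2 fun h => hza (hinj hz ha h)) (sub_ne_zero.2 hza)
  have hdiff : DifferentiableOn ℂ (fun z => (dslope f a z)⁻¹) (Metric.ball a r) :=
    ((Complex.differentiableOn_dslope (Metric.isOpen_ball.mem_nhds ha)).2 hf).inv hne
  obtain ⟨b, hb, hmax⟩ := Complex.exists_mem_frontier_isMaxOn_norm Metric.isBounded_ball
    ⟨a, Metric.mem_ball_self ht⟩ (DifferentiableOn.diffContOnCl (hdiff.mono
      ((closure_ball a ht.ne').trans_subset hsub)))
  rw [frontier_ball a ht.ne'] at hb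
  have hba : b ≠ a := Metric.ne_of_mem_sphere hb ht.ne'
  have hle : ‖(deriv f a)⁻¹‖ ≤ ‖(dslope f a b)⁻¹‖ := by
    simpa using isMaxOn_iff.1 hmax a (subset_closure (Metric.mem_ball_self ht))
  rw [norm_inv, norm_inv, inv_le_inv₀ (norm_pos_iff.2 hfa)
    (norm_pos_iff.2 (hne b (hsub (Metric.sphere_subset_closedBall hb)))), dslope_of_ne _ hba,
    slope_def_field, norm_div, mem_sphere_iff_norm.1 hb, div_le_iff₀ ht] at hle
  exact ⟨b, hb, by linarith⟩

lemma norm_sub_le_two_mul_of_notMem_image {f : ℂ → ℂ} {a v : ℂ} {r : ℝ} (hr : 0 < r)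
    (hf : DifferentiableOn ℂ f (Metric.ball a r)) (hinj : InjOn f (Metric.ball a r))
    (hv : v ∉ f '' Metric.ball a r) {z : ℂ} (hz : z ∈ Metric.closedBall a (r / 4000)) :
    ‖f z - v‖ ≤ 2 * ‖f a - v‖ := by
  have hsub : ∀ z ∈ Metric.closedBall a (r / 4000), Metric.ball z (r / 2) ⊆ Metric.ball a r :=
    fun z hz => Metric.ball_subset_ball' (by linarith [Metric.mem_closedBall.1 hz])
  have hdiff : ∀ z ∈ Metric.closedBall a (r / 4000), DifferentiableAt ℂ f z := fun z hz =>
    hf.differentiableAt (Metric.isOpen_ball.mem_nhds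
      (hsub z hz (Metric.mem_ball_self (half_pos hr))))
  obtain ⟨b, hb, hmax⟩ := (isCompact_closedBall a (r / 4000)).exists_isMaxOn ⟨z, hz⟩
    (f := fun z => ‖f z - v‖) fun z hz =>
      ((hdiff z hz).sub_const v).continuousAt.norm.continuousWithinAt
  rw [isMaxOn_iff] at hmax
  have hderiv : ∀ z ∈ Metric.closedBall a (r / 4000), ‖deriv f z‖ ≤ 2000 / r * ‖f b - v‖ := by
    intro z hz
    have := norm_deriv_mul_le_of_notMem_image (half_pos hr) (hf.mono (hsub z hz))
      (hinj.mono (hsub z hz)) fun h => hv (image_mono (hsub z hz) h)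
    rw [div_mul_eq_mul_div, le_div_iff₀ hr]
    linarith [hmax z hz]
  have hba : ‖f b - f a‖ ≤ ‖f b - v‖ / 2 := by
    calc ‖f b - f a‖ ≤ 2000 / r * ‖f b - v‖ * ‖b - a‖ :=
          (convex_closedBall a (r / 4000)).norm_image_sub_le_of_norm_deriv_le hdiff hderiv
            (Metric.mem_closedBall_self (by positivity)) hb
      _ ≤ 2000 / r * ‖f b - v‖ * (r / 4000) := by gcongr; exact mem_closedBall_iff_norm.1 hb
      _ = ‖f b - v‖ / 2 := by field_simp; ring
  linarith [hmax z hz, norm_sub_le_norm_sub_add_norm_sub (f b) (f a) v]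

-- The minimum principle for the difference quotient provides a value near `f a` that `f` omits on
-- the disc of radius `r / 2`; the distance to an omitted value bounds the derivative.
lemma norm_deriv_sub_le_of_injOn {f : ℂ → ℂ} {a : ℂ} {r : ℝ} (hr : 0 < r)
    (hf : DifferentiableOn ℂ f (Metric.ball a r)) (hinj : InjOn f (Metric.ball a r))
    (hfa : deriv f a ≠ 0) {z : ℂ} (hz : z ∈ Metric.closedBall a (r / 10 ^ 9)) :
    ‖deriv f z - deriv f a‖ ≤ ‖deriv f a‖ / 2 := by
  obtain ⟨b, hb, hba⟩ := exists_mem_sphere_norm_sub_le (half_pos hr) (half_lt_self hr) hf hinj hfa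
  rw [mem_sphere_iff_norm] at hb
  have hsub : ∀ z ∈ Metric.ball a (r / 8000), Metric.ball z (r / 4) ⊆ Metric.ball a (r / 2) :=
    fun z hz => Metric.ball_subset_ball' (by linarith [Metric.mem_ball.1 hz])
  have hhalf : Metric.ball a (r / 2) ⊆ Metric.ball a r := Metric.ball_subset_ball (by linarith)
  have homit : f b ∉ f '' Metric.ball a (r / 2) := by
    rintro ⟨z, hz, hzb⟩
    have hbr : b ∈ Metric.ball a r := mem_ball_iff_norm.2 (by linarith)
    rw [hinj (hhalf hz) hbr hzb, mem_ball_iff_norm] at hz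
    linarith
  have hderiv : ∀ z ∈ Metric.ball a (r / 8000), ‖deriv f z‖ ≤ 4000 * ‖deriv f a‖ := by
    intro z hz
    have hz2 : ‖f z - f b‖ ≤ 2 * ‖f a - f b‖ := norm_sub_le_two_mul_of_notMem_image (half_pos hr)
      (hf.mono hhalf) (hinj.mono hhalf) homit (by
        rw [div_div]; exact Metric.ball_subset_closedBall (by norm_num; exact hz))
    have hz4 := norm_deriv_mul_le_of_notMem_image (by positivity)
      (hf.mono ((hsub z hz).trans hhalf)) (hinj.mono ((hsub z hz).trans hhalf))
      fun h => homit (image_mono (hsub z hz) h)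
    rw [norm_sub_rev] at hba
    refine le_of_mul_le_mul_right ?_ (by positivity : 0 < r / 4)
    linarith
  calc ‖deriv f z - deriv f a‖ ≤ 2 * (4000 * ‖deriv f a‖) / (r / 8000) * ‖z - a‖ :=
        norm_deriv_sub_le_of_norm_deriv_le
          (hf.mono (Metric.ball_subset_ball (by linarith))) hderiv
          (Metric.closedBall_subset_ball (by linarith) hz)
    _ ≤ 2 * (4000 * ‖deriv f a‖) / (r / 8000) * (r / 10 ^ 9) := by
        gcongr; exact mem_closedBall_iff_norm.1 hz
    _ ≤ ‖deriv f a‖ / 2 := by field_simp; norm_num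

/-! ### Logarithmic coordinates -/

lemma exists_continuousOn_lift {X E B : Type*} [TopologicalSpace X] [TopologicalSpace E]
    [TopologicalSpace B] {p : E → B} {D : Set E} {Ω : Set B} (hmaps : MapsTo p D Ω)
    (hp : IsCoveringMap (hmaps.restrict p D Ω)) (hsurj : SurjOn p D Ω) {U : Set X}
    (hU : IsSimplyConnected U) [LocallyPathConnectedSpace U] {φ : X → B} (hφ : ContinuousOn φ U)
    (hφU : MapsTo φ U Ω) :
    ∃ G : X → E, ContinuousOn G U ∧ MapsTo G U D ∧ EqOn (p ∘ G) φ U := by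
  have := hU.simplyConnectedSpace
  obtain ⟨x₀, hx₀⟩ := hU.nonempty
  obtain ⟨z₀, hz₀D, hz₀⟩ := hsurj (hφU hx₀)
  obtain ⟨Γ, ⟨-, hΓ⟩, -⟩ := hp.existsUnique_continuousMap_lifts
    ⟨hφU.restrict φ U Ω, hφ.mapsToRestrict hφU⟩ ⟨x₀, hx₀⟩ ⟨z₀, hz₀D⟩ (Subtype.ext hz₀)
  classical
  let G : X → E := fun x => if hx : x ∈ U then (Γ ⟨x, hx⟩ : E) else z₀
  have hG : ∀ x : U, G x = Γ x := fun x => by simp [G]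
  refine ⟨G, ?_, fun x hx => hG ⟨x, hx⟩ ▸ (Γ ⟨x, hx⟩).2, fun x hx => ?_⟩
  · rw [continuousOn_iff_continuous_domRestrict, show U.domRestrict G = fun x => (Γ x : E) from
      funext hG]
    fun_prop
  · rw [Function.comp_apply, hG ⟨x, hx⟩]
    exact congrArg Subtype.val (congrFun hΓ ⟨x, hx⟩)

lemma isOpen_re_gt (a : ℝ) : IsOpen {w : ℂ | a < w.re} :=
  isOpen_lt continuous_const Complex.continuous_re

lemma isSimplyConnected_re_gt (a : ℝ) : IsSimplyConnected {w : ℂ | a < w.re} :=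
  isSimplyConnected_of_convex (convex_halfSpace_re_gt a) ⟨((a + 1 : ℝ) : ℂ), by simp⟩

lemma injOn_of_exp_comp_eq {G L : ℂ → ℂ} {U V : Set ℂ} (hU : IsOpen U) (hc : IsPreconnected U)
    (hG : ContinuousOn G U) (hGV : MapsTo G U V) (hL : ContinuousOn L V)
    (h : ∀ w ∈ U, Complex.exp (L (G w)) = Complex.exp w) : InjOn G U := by
  have hexp : EqOn (Complex.exp ∘ fun w => L (G w) - w) (fun _ => 1) U := fun w hw => by
    simp [Complex.exp_sub, h w hw]
  have hdiff : DifferentiableOn ℂ (fun w => L (G w) - w) U :=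
    differentiableOn_of_exp_comp_eqOn hU ((hL.comp hG hGV).sub continuousOn_id) hexp
      (differentiableOn_const _)
  have hderiv : EqOn (deriv fun w => L (G w) - w) 0 U := fun w hw => by
    simpa using (deriv_eq_mul_deriv_of_exp_comp_eventuallyEq
      (hdiff.differentiableAt (hU.mem_nhds hw)) (hexp.eventuallyEq_of_mem (hU.mem_nhds hw))).symm
  intro w hw w' hw' hww'
  have := hU.is_const_of_deriv_eq_zero hc hdiff hderiv hw hw'
  simp only [hww'] at this
  linear_combination -this

lemma exists_inverse_branch {f : ℂ → ℂ} {D : Set ℂ} {R : ℝ} (hD : IsOpen D)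
    (hf : DifferentiableOn ℂ f D) (hR : 0 < R)
    (hcov : IsUniversalCoveringOnto f D {w : ℂ | R < ‖w‖}) :
    ∃ G : ℂ → ℂ, DifferentiableOn ℂ G {w | Real.log R < w.re} ∧
      InjOn G {w | Real.log R < w.re} ∧ MapsTo G {w | Real.log R < w.re} D ∧
      EqOn (f ∘ G) Complex.exp {w | Real.log R < w.re} := by
  obtain ⟨hsc, himg, hmaps, hcov⟩ := hcov
  have hU := isOpen_re_gt (Real.log R)
  have := hU.locallyPathConnectedSpace
  have hexp : MapsTo Complex.exp {w | Real.log R < w.re} {w : ℂ | R < ‖w‖} := fun w hw => by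
    rw [mem_ofPred_eq, Complex.norm_exp]
    exact (Real.log_lt_iff_lt_exp hR).1 hw
  obtain ⟨G, hGc, hGD, hfG⟩ := exists_continuousOn_lift hmaps hcov himg.ge
    (isSimplyConnected_re_gt (Real.log R)) Complex.continuous_exp.continuousOn hexp
  obtain ⟨L, hLc, hL⟩ := Complex.exists_continuousOn_eqOn_exp_comp hsc hD hf.continuousOn
    (by simpa [himg] using hR.le)
  have hinj : InjOn G {w | Real.log R < w.re} :=
    injOn_of_exp_comp_eq hU (convex_halfSpace_re_gt _).isPreconnected hGc hGD hLc
      fun w hw => (hL (hGD hw)).trans (hfG hw)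
  exact ⟨G, differentiableOn_of_comp_eqOn hU hD hGc hinj hGD hf hfG
    Complex.differentiable_exp.differentiableOn (fun w _ => by simp [Complex.exp_ne_zero]),
    hinj, hGD, hfG⟩

lemma exists_log_coordinate {f : ℂ → ℂ} {D : Set ℂ} {R p r : ℝ} (hD : IsOpen D)
    (hf : DifferentiableOn ℂ f D) (hbdd : ∀ ρ, ∃ M, ∀ z ∈ D, ‖z‖ ≤ ρ → ‖f z‖ ≤ M) (hR : 0 < R)
    (hcov : IsUniversalCoveringOnto f D {w : ℂ | R < ‖w‖})
    (hr : ∀ z ∈ D, r ≤ ‖z‖ → ‖f z‖ ≤ Real.exp (Real.exp (Real.log ‖z‖ ^ p))) :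
    ∃ (a : ℝ) (g : ℂ → ℂ), DifferentiableOn ℂ g {w | a < w.re} ∧
      InjOn (fun w => Complex.exp (g w)) {w | a < w.re} ∧
      ∀ w : ℂ, a < w.re → Complex.exp (g w) ∈ D ∧ f (Complex.exp (g w)) = Complex.exp w ∧
        0 < (g w).re ∧ w.re ≤ Real.exp ((g w).re ^ p) := by
  obtain ⟨G, hGd, hGi, hGD, hfG⟩ := exists_inverse_branch hD hf hR hcov
  obtain ⟨M, hM⟩ := hbdd (max r 1)
  have hsub : {w : ℂ | max (Real.log R) M < w.re} ⊆ {w | Real.log R < w.re} := fun w hw =>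
    (le_max_left _ M).trans_lt (show max (Real.log R) M < w.re from hw)
  have hbig : ∀ w : ℂ, max (Real.log R) M < w.re → max r 1 < ‖G w‖ := by
    intro w hw
    by_contra! h
    have hle := hM (G w) (hGD (hsub hw)) h
    rw [show f (G w) = _ from hfG (hsub hw), Complex.norm_exp] at hle
    linarith [Real.add_one_le_exp w.re, (le_max_right _ _).trans_lt hw]
  obtain ⟨g, hgd, hg⟩ := exists_differentiableOn_log (isOpen_re_gt _)
    (isSimplyConnected_re_gt _) (hGd.mono hsub) fun w hw => norm_pos_iff.1 <|
      (zero_lt_one.trans_le (le_max_right r 1)).trans (hbig w hw)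
  replace hg : ∀ w : ℂ, max (Real.log R) M < w.re → Complex.exp (g w) = G w := fun _ hw => hg hw
  refine ⟨max (Real.log R) M, g, hgd, fun x hx y hy hxy => ?_, fun w hw => ?_⟩
  · exact hGi (hsub hx) (hsub hy) (by rw [← hg x hx, ← hg y hy]; exact hxy)
  have hnorm := hbig w hw
  have hgrowth := hr _ (hGD (hsub hw)) ((le_max_left r 1).trans hnorm.le)
  rw [show f (G w) = _ from hfG (hsub hw), ← hg w hw, Complex.norm_exp, Complex.norm_exp,
    Real.log_exp] at hgrowth
  rw [← hg w hw, Complex.norm_exp] at hnorm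
  rw [hg w hw]
  exact ⟨hGD (hsub hw), hfG (hsub hw),
    Real.one_lt_exp_iff.1 ((le_max_right r 1).trans_lt hnorm), Real.exp_le_exp.1 hgrowth⟩

/-! ### Level crossings of real functions -/

lemma exists_crossing_interval {v : ℝ → ℝ} {A B c d : ℝ} (hAB : A ≤ B)
    (hv : ContinuousOn v (Icc A B)) (hc : v A ≤ c) (hcd : c < d) (hd : d ≤ v B) :
    ∃ a b, A ≤ a ∧ a < b ∧ b ≤ B ∧ v a = c ∧ v b = d ∧ MapsTo v (Ioo a b) (Ioo c d) := by
  obtain ⟨b, ⟨hb, hbd : v b = d⟩, hbmin⟩ := (isCompact_Icc.of_isClosed_subset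
    (hv.preimage_isClosed_of_isClosed isClosed_Icc isClosed_singleton)
    inter_subset_left).exists_isLeast (intermediate_value_Icc hAB hv ⟨hc.trans hcd.le, hd⟩)
  have hvb : ContinuousOn v (Icc A b) := hv.mono (Icc_subset_Icc_right hb.2)
  obtain ⟨a, ⟨ha, hac : v a = c⟩, hamax⟩ := (isCompact_Icc.of_isClosed_subset
    (hvb.preimage_isClosed_of_isClosed isClosed_Icc isClosed_singleton)
    inter_subset_left).exists_isGreatest
      (intermediate_value_Icc hb.1 hvb ⟨hc, hcd.le.trans hbd.ge⟩)
  have hab : a < b := ha.2.lt_of_ne (by rintro rfl; linarith)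
  refine ⟨a, b, ha.1, hab, hb.2, hac, hbd, fun x hx => ⟨?_, ?_⟩⟩
  · by_contra! h
    obtain ⟨y, hy, hyc⟩ := intermediate_value_Icc hx.2.le
      (hvb.mono (Icc_subset_Icc_left (ha.1.trans hx.1.le))) ⟨h, hcd.le.trans hbd.ge⟩
    linarith [hamax ⟨⟨ha.1.trans (hx.1.le.trans hy.1), hy.2⟩, hyc⟩, hx.1, hy.1]
  · by_contra! h
    obtain ⟨y, hy, hyd⟩ := intermediate_value_Icc (ha.1.trans hx.1.le)
      (hvb.mono (Icc_subset_Icc_right hx.2.le)) ⟨hc.trans hcd.le, h⟩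
    linarith [hbmin ⟨⟨hy.1, hy.2.trans (hx.2.le.trans hb.2)⟩, hyd⟩, hx.2, hy.2]

lemma sum_sub_le_of_pairwiseDisjoint_Ioo {ι : Type*} {S : Finset ι} {a b : ι → ℝ} {A B : ℝ}
    (hAB : A ≤ B) (hab : ∀ i ∈ S, a i ≤ b i) (hsub : ∀ i ∈ S, Ioo (a i) (b i) ⊆ Icc A B)
    (hdisj : (S : Set ι).PairwiseDisjoint fun i => Ioo (a i) (b i)) :
    ∑ i ∈ S, (b i - a i) ≤ B - A := by
  have hvol : volume (⋃ i ∈ S, Ioo (a i) (b i)) ≤ volume (Icc A B) :=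
    measure_mono (iUnion₂_subset hsub)
  rw [measure_biUnion_finset hdisj fun _ _ => measurableSet_Ioo] at hvol
  simp only [Real.volume_Ioo, Real.volume_Icc] at hvol
  rwa [← ENNReal.ofReal_sum_of_nonneg fun i hi => sub_nonneg.2 (hab i hi),
    ENNReal.ofReal_le_ofReal_iff (sub_nonneg.2 hAB)] at hvol

lemma card_le_two_mul_card_filter_mul_le {ι : Type*} {S : Finset ι} {ℓ : ι → ℝ} {L : ℝ}
    (hL : 0 < L) (hℓ : ∀ i ∈ S, 0 ≤ ℓ i) (hsum : ∑ i ∈ S, ℓ i ≤ L) :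
    S.card ≤ 2 * (S.filter fun i => S.card * ℓ i ≤ 2 * L).card := by
  have hcard := S.card_filter_add_card_filter_not fun i => S.card * ℓ i ≤ 2 * L
  set T := S.filter fun i => ¬ S.card * ℓ i ≤ 2 * L
  have hlong : (T.card : ℝ) * (2 * L) ≤ S.card * L := by
    calc (T.card : ℝ) * (2 * L) = ∑ i ∈ T, 2 * L := by rw [Finset.sum_const, nsmul_eq_mul]
      _ ≤ ∑ i ∈ T, S.card * ℓ i :=
          Finset.sum_le_sum fun i hi => (not_le.1 (Finset.mem_filter.1 hi).2).le
      _ ≤ ∑ i ∈ S, S.card * ℓ i :=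
          Finset.sum_le_sum_of_subset_of_nonneg (Finset.filter_subset _ _)
            fun i hi _ => mul_nonneg (Nat.cast_nonneg _) (hℓ i hi)
      _ ≤ S.card * L := by rw [← Finset.mul_sum]; gcongr
  have hhalf : 2 * T.card ≤ S.card := by
    have : (2 * T.card : ℝ) ≤ S.card := le_of_mul_le_mul_right (by linarith) hL
    exact_mod_cast this
  omega

lemma exists_level_crossing_intervals {v : ℝ → ℝ} {A B t d : ℝ} {M : ℕ} (hAB : A ≤ B)
    (hv : ContinuousOn v (Icc A B)) (hd : 0 < d) (hA : v A ≤ t) (hB : t + 2 * M * d ≤ v B) :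
    ∃ a b : ℕ → ℝ, (∀ j ∈ Finset.range M, A ≤ a j ∧ a j < b j ∧ b j ≤ B ∧
        v (b j) - v (a j) = d ∧
        MapsTo v (Ioo (a j) (b j)) (Ioo (t + 2 * j * d) (t + (2 * j + 1) * d))) ∧
      (Finset.range M : Set ℕ).PairwiseDisjoint fun j => Ioo (a j) (b j) := by
  have hcross : ∀ j : ℕ, ∃ a b, j ∈ Finset.range M → A ≤ a ∧ a < b ∧ b ≤ B ∧ v b - v a = d ∧
      MapsTo v (Ioo a b) (Ioo (t + 2 * j * d) (t + (2 * j + 1) * d)) := by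
    intro j
    by_cases hj : j ∈ Finset.range M
    · have hj' : (j : ℝ) + 1 ≤ M := by exact_mod_cast Finset.mem_range.1 hj
      have hjd : 0 ≤ 2 * (j : ℝ) * d := by positivity
      obtain ⟨a, b, hAa, hab, hbB, hva, hvb, hmaps⟩ := exists_crossing_interval
        (c := t + 2 * j * d) (d := t + (2 * j + 1) * d) hAB hv (by linarith) (by linarith)
        (by nlinarith)
      exact ⟨a, b, fun _ => ⟨hAa, hab, hbB, by rw [hva, hvb]; ring, hmaps⟩⟩
    · exact ⟨0, 0, fun h => absurd h hj⟩
  choose a b hab using hcross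
  have hlt {i j : ℕ} (hi : i ∈ Finset.range M) (hj : j ∈ Finset.range M) (hij : i < j) :
      Disjoint (Ioo (a i) (b i)) (Ioo (a j) (b j)) := by
    refine Set.disjoint_left.2 fun x hxi hxj => ?_
    have hvi := ((hab i hi).2.2.2.2 hxi).2
    have hvj := ((hab j hj).2.2.2.2 hxj).1
    have hij' : (i : ℝ) + 1 ≤ j := by exact_mod_cast hij
    nlinarith
  exact ⟨a, b, hab, fun i hi j hj hij =>
    hij.lt_or_gt.elim (hlt hi hj) fun h => (hlt hj hi h).symm⟩

lemma exists_hasDerivAt_steep_on_level {v v' : ℝ → ℝ} {A B t ρ : ℝ} (hAB : A < B)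
    (hv : ∀ x ∈ Icc A B, HasDerivAt v (v' x) x) (hρ : 0 < ρ) (hA : v A ≤ t) (hB : t + ρ ≤ v B)
    {M : ℕ} (hM : 0 < M) :
    ∃ J : Finset ℕ, (∀ j ∈ J, j < M) ∧ M ≤ 2 * J.card ∧ ∀ j ∈ J, ∃ ξ ∈ Icc A B,
      v ξ ∈ Icc (t + 2 * j * (ρ / (2 * M))) (t + (2 * j + 1) * (ρ / (2 * M))) ∧
      ρ / (4 * (B - A)) ≤ v' ξ := by
  have hM' : (0 : ℝ) < M := by exact_mod_cast hM
  have hdM : 2 * M * (ρ / (2 * M)) = ρ := by field_simp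
  have hvc : ContinuousOn v (Icc A B) := fun x hx => (hv x hx).continuousAt.continuousWithinAt
  obtain ⟨a, b, hab, hdisj⟩ := exists_level_crossing_intervals hAB.le hvc
    (by positivity : 0 < ρ / (2 * M)) hA (hdM.symm ▸ hB)
  have hsum : ∑ j ∈ Finset.range M, (b j - a j) ≤ B - A :=
    sum_sub_le_of_pairwiseDisjoint_Ioo hAB.le (fun j hj => (hab j hj).2.1.le)
      (fun j hj => Ioo_subset_Icc_self.trans (Icc_subset_Icc (hab j hj).1 (hab j hj).2.2.1)) hdisj
  have hcard := card_le_two_mul_card_filter_mul_le (sub_pos.2 hAB)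
    (fun j hj => sub_nonneg.2 (hab j hj).2.1.le) hsum
  rw [Finset.card_range] at hcard
  refine ⟨_, fun j hj => Finset.mem_range.1 (Finset.mem_filter.1 hj).1, hcard, fun j hj => ?_⟩
  obtain ⟨hjM, hshort⟩ := Finset.mem_filter.1 hj
  obtain ⟨hAa, hlt, hbB, hvab, hmaps⟩ := hab j hjM
  have hsub : Icc (a j) (b j) ⊆ Icc A B := Icc_subset_Icc hAa hbB
  obtain ⟨ξ, hξ, hslope⟩ := exists_hasDerivAt_eq_slope v v' hlt (hvc.mono hsub)
    fun x hx => hv x (hsub (Ioo_subset_Icc_self hx))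
  refine ⟨ξ, hsub (Ioo_subset_Icc_self hξ), Ioo_subset_Icc_self (hmaps hξ), ?_⟩
  rw [hslope, hvab, div_div, div_le_div_iff_of_pos_left hρ (by linarith) (by nlinarith)]
  linarith

lemma card_le_of_forall_sub_le {F : Finset ℕ} {d : ℝ} (hd : 0 ≤ d)
    (h : ∀ i ∈ F, ∀ j ∈ F, (j : ℝ) - i ≤ d) : (F.card : ℝ) ≤ d + 1 := by
  rcases F.eq_empty_or_nonempty with rfl | hF
  · simpa using hd.trans (le_add_of_nonneg_right zero_le_one)
  have hcard : F.card ≤ F.max' hF + 1 - F.min' hF :=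
    (Finset.card_le_card fun i hi => Finset.mem_Icc.2 ⟨F.min'_le i hi, F.le_max' i hi⟩).trans_eq
      (Nat.card_Icc _ _)
  have hcard' : (F.card : ℝ) + F.min' hF ≤ F.max' hF + 1 := by
    have := F.min'_le _ (F.max'_mem hF)
    exact_mod_cast (by omega : F.card + F.min' hF ≤ F.max' hF + 1)
  linarith [h _ (F.min'_mem hF) _ (F.max'_mem hF)]

/-! ### Discs and their children -/

/-- `g` is the logarithm of a conformal map of the half-plane `Re w > a`, and its real part is at
least `(log Re w) ^ (1 / p)`: the inverse function of a logarithmic tract in logarithmic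
coordinates. -/
structure IsTractLog (g : ℂ → ℂ) (a p : ℝ) : Prop where
  one_le : 1 ≤ a
  differentiableOn : DifferentiableOn ℂ g {w | a < w.re}
  injOn : InjOn (fun w => Complex.exp (g w)) {w | a < w.re}
  growth : ∀ w : ℂ, a < w.re → 0 < (g w).re ∧ w.re ≤ Real.exp ((g w).re ^ p)

/-- The radius of discs, relative to the distance of their centre from the imaginary axis, on
which the distortion of a conformal map of a half-plane is controlled; its value is not
optimised. -/
noncomputable def distortionRadius : ℝ := 1 / 10 ^ 10

lemma distortionRadius_pos : 0 < distortionRadius := by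
  unfold distortionRadius; positivity

lemma distortionRadius_le : distortionRadius ≤ 1 / 6 := by
  unfold distortionRadius; norm_num

lemma ball_half_subset_re_gt {a x : ℝ} (hx : 2 * a ≤ x) :
    Metric.ball (x : ℂ) (x / 2) ⊆ {w | a < w.re} := by
  intro w hw
  have hre := (Complex.re_le_norm ((x : ℂ) - w)).trans_lt (mem_ball_iff_norm'.1 hw)
  rw [Complex.sub_re, Complex.ofReal_re] at hre
  change a < w.re
  linarith

namespace IsTractLog

variable {g : ℂ → ℂ} {a p : ℝ}

lemma differentiableAt (hg : IsTractLog g a p) {w : ℂ} (hw : a < w.re) : DifferentiableAt ℂ g w :=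
  hg.differentiableOn.differentiableAt ((isOpen_re_gt a).mem_nhds hw)

lemma closedBall_subset (hg : IsTractLog g a p) {x : ℝ} (hx : 2 * a ≤ x) :
    Metric.closedBall (x : ℂ) (distortionRadius * x) ⊆ Metric.ball (x : ℂ) (x / 2) :=
  Metric.closedBall_subset_ball (by nlinarith [hg.one_le, distortionRadius_le])

lemma norm_deriv_mul_le (hg : IsTractLog g a p) {x : ℝ} (hx : 2 * a ≤ x) :
    ‖deriv g x‖ * x ≤ 2000 := by
  have hsub := ball_half_subset_re_gt hx
  linarith [norm_deriv_mul_le_of_exp_injOn (by linarith [hg.one_le])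
    (hg.differentiableOn.mono hsub) (hg.injOn.mono hsub)]

lemma norm_sub_sub_mul_le (hg : IsTractLog g a p) {x : ℝ} (hx : 2 * a ≤ x)
    (h0 : deriv g x ≠ 0) {w w' : ℂ}
    (hw : w ∈ Metric.closedBall (x : ℂ) (distortionRadius * x))
    (hw' : w' ∈ Metric.closedBall (x : ℂ) (distortionRadius * x)) :
    ‖g w - g w' - deriv g x * (w - w')‖ ≤ ‖deriv g x‖ / 2 * ‖w - w'‖ := by
  have hx0 : 0 < x := by linarith [hg.one_le]
  have hsub := ball_half_subset_re_gt hx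
  refine norm_sub_sub_mul_le_of_norm_deriv_sub_le (convex_closedBall _ _)
    (fun z hz => hg.differentiableAt (hsub (hg.closedBall_subset hx hz))) (fun z hz => ?_) hw hw'
  refine norm_deriv_sub_le_of_injOn (half_pos hx0) (hg.differentiableOn.mono hsub)
    (fun y hy z hz hyz => hg.injOn (hsub hy) (hsub hz) (congrArg Complex.exp hyz)) h0 ?_
  refine Metric.closedBall_subset_closedBall ?_ hz
  unfold distortionRadius
  linarith

lemma norm_sub_le (hg : IsTractLog g a p) {x : ℝ} (hx : 2 * a ≤ x)
    (h0 : deriv g x ≠ 0) {w w' : ℂ}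
    (hw : w ∈ Metric.closedBall (x : ℂ) (distortionRadius * x))
    (hw' : w' ∈ Metric.closedBall (x : ℂ) (distortionRadius * x)) :
    ‖g w - g w'‖ ≤ 3 / 2 * ‖deriv g x‖ * ‖w - w'‖ := by
  have h := norm_le_norm_sub_add (g w - g w') (deriv g x * (w - w'))
  rw [norm_mul] at h
  linarith [hg.norm_sub_sub_mul_le hx h0 hw hw']

lemma le_norm_sub (hg : IsTractLog g a p) {x : ℝ} (hx : 2 * a ≤ x)
    (h0 : deriv g x ≠ 0) {w w' : ℂ}
    (hw : w ∈ Metric.closedBall (x : ℂ) (distortionRadius * x))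
    (hw' : w' ∈ Metric.closedBall (x : ℂ) (distortionRadius * x)) :
    1 / 2 * ‖deriv g x‖ * ‖w - w'‖ ≤ ‖g w - g w'‖ := by
  have h := norm_le_norm_add_norm_sub (g w - g w') (deriv g x * (w - w'))
  rw [norm_mul] at h
  linarith [hg.norm_sub_sub_mul_le hx h0 hw hw']

lemma two_mul_le_exp (hg : IsTractLog g a p) {L : ℝ} (hL : Real.log (2 * a) ≤ L) :
    2 * a ≤ Real.exp L :=
  (Real.log_le_iff_le_exp (by linarith [hg.one_le])).1 hL

lemma log_two_mul_nonneg (hg : IsTractLog g a p) : 0 ≤ Real.log (2 * a) :=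
  Real.log_nonneg (by linarith [hg.one_le])

lemma lt_re_exp (hg : IsTractLog g a p) {L : ℝ} (hL : Real.log (2 * a) ≤ L) :
    a < ((Real.exp L : ℝ) : ℂ).re := by
  rw [Complex.ofReal_re]
  linarith [hg.one_le, hg.two_mul_le_exp hL]

lemma hasDerivAt_re (hg : IsTractLog g a p) {L : ℝ} (hL : Real.log (2 * a) ≤ L) :
    HasDerivAt (fun L : ℝ => (g (Real.exp L : ℝ)).re)
      (deriv g (Real.exp L : ℝ) * (Real.exp L : ℝ)).re L := by
  have hcomp : HasDerivAt (fun L : ℝ => g (Real.exp L : ℝ))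
      (deriv g (Real.exp L : ℝ) * (Real.exp L : ℝ)) L :=
    HasDerivAt.comp L (hg.differentiableAt (hg.lt_re_exp hL)).hasDerivAt
      (Real.hasDerivAt_exp L).ofReal_comp
  exact Complex.reCLM.hasFDerivAt.comp_hasDerivAt L hcomp

lemma re_deriv_mul_exp_le {L : ℝ} : (deriv g (Real.exp L : ℝ) * (Real.exp L : ℝ)).re ≤
    ‖deriv g (Real.exp L : ℝ)‖ * Real.exp L := by
  refine (Complex.re_le_norm _).trans_eq ?_
  rw [norm_mul, Complex.norm_of_nonneg (Real.exp_pos L).le]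

lemma re_exp_le (hg : IsTractLog g a p) {L : ℝ} (hL : Real.log (2 * a) ≤ L) :
    (g (Real.exp L : ℝ)).re ≤ (g (2 * a : ℝ)).re + 2000 * L := by
  have hmvt := (convex_Icc (Real.log (2 * a)) L).image_sub_le_mul_sub_of_deriv_le
    (f := fun L : ℝ => (g (Real.exp L : ℝ)).re) (C := 2000)
    (fun x hx => (hg.hasDerivAt_re hx.1).continuousAt.continuousWithinAt)
    (fun x hx => (hg.hasDerivAt_re
      (interior_subset hx).1).differentiableAt.differentiableWithinAt)
    (fun x hx => by
      have hx' := (interior_subset hx).1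
      rw [(hg.hasDerivAt_re hx').deriv]
      exact re_deriv_mul_exp_le.trans (hg.norm_deriv_mul_le (hg.two_mul_le_exp hx')))
    _ (left_mem_Icc.2 hL) _ (right_mem_Icc.2 hL) hL
  rw [Real.exp_log (by linarith [hg.one_le])] at hmvt
  linarith [hg.log_two_mul_nonneg]

lemma le_re_exp_rpow (hg : IsTractLog g a p) {L : ℝ} (hL : Real.log (2 * a) ≤ L) :
    0 < (g (Real.exp L : ℝ)).re ∧ L ≤ (g (Real.exp L : ℝ)).re ^ p := by
  obtain ⟨hpos, hle⟩ := hg.growth _ (hg.lt_re_exp hL)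
  exact ⟨hpos, Real.exp_le_exp.1 hle⟩

lemma one_le_exponent (hg : IsTractLog g a p) (hp : 0 < p) : 1 ≤ p := by
  by_contra! hp1
  have hlarge : ∀ᶠ L in atTop, (2001 : ℝ) ^ p < L ^ (1 - p) :=
    (tendsto_rpow_atTop (by linarith : 0 < 1 - p)).eventually_gt_atTop _
  obtain ⟨L, hL, hLa, hLv, hL0⟩ := (hlarge.and ((eventually_ge_atTop (Real.log (2 * a))).and
    ((eventually_ge_atTop (g (2 * a : ℝ)).re).and (eventually_gt_atTop 0)))).exists
  obtain ⟨hpos, hle⟩ := hg.le_re_exp_rpow hLa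
  have hcontr : L < L := by
    calc L ≤ (g (Real.exp L : ℝ)).re ^ p := hle
      _ ≤ (2001 * L) ^ p := Real.rpow_le_rpow hpos.le (by linarith [hg.re_exp_le hLa]) hp.le
      _ = 2001 ^ p * L ^ p := Real.mul_rpow (by norm_num) hL0.le
      _ < L ^ (1 - p) * L ^ p := mul_lt_mul_of_pos_right hL (Real.rpow_pos_of_pos hL0 p)
      _ = L := by rw [← Real.rpow_add hL0, sub_add_cancel, Real.rpow_one]
  exact hcontr.false

end IsTractLog

/-- A lower bound for the points `x` of the real axis with `Re g(x) ≥ X / 2`. -/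
noncomputable def hittingBound (g : ℂ → ℂ) (a X : ℝ) : ℝ :=
  Real.exp ((X / 2 - (g (2 * a : ℝ)).re) / 2000)

/-- The conditions on the size of the centre `X` of a disc under which the construction of the
children of the disc succeeds. -/
structure IsLarge (g : ℂ → ℂ) (a p s X : ℝ) : Prop where
  two_mul_le : 2 * a ≤ X
  re_le : (g (2 * a : ℝ)).re ≤ X / 2
  add_one_le : X + 1 ≤ hittingBound g a X
  mul_rpow_le : 2 ^ (p * (s - 1)) * (8000 / distortionRadius * (2 * X) ^ p) ≤
    hittingBound g a X ^ (1 - p * (s - 1))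

lemma IsTractLog.hittingBound_le {g : ℂ → ℂ} {a p : ℝ} (hg : IsTractLog g a p) {X L : ℝ}
    (hL : Real.log (2 * a) ≤ L) (hX : X / 2 ≤ (g (Real.exp L : ℝ)).re) :
    hittingBound g a X ≤ Real.exp L :=
  Real.exp_le_exp.2 (by linarith [hg.re_exp_le hL])

lemma eventually_const_mul_rpow_le_exp (C p c : ℝ) {b : ℝ} (hb : 0 < b) :
    ∀ᶠ x in atTop, C * x ^ p ≤ Real.exp (b * x - c) := by
  filter_upwards [((isLittleO_rpow_exp_pos_mul_atTop p hb).const_mul_left C).bound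
    (Real.exp_pos (-c))] with x hx
  rw [Real.norm_of_nonneg (Real.exp_pos (b * x)).le, ← Real.exp_add] at hx
  rw [sub_eq_neg_add]
  exact (Real.le_norm_self _).trans hx

lemma eventually_isLarge (g : ℂ → ℂ) (a : ℝ) {p s : ℝ} (hps : p * (s - 1) < 1) :
    ∀ᶠ X in atTop, IsLarge g a p s X := by
  set v := (g (2 * a : ℝ)).re with hv
  set θ := p * (s - 1) with hθ
  filter_upwards [eventually_ge_atTop (2 * a), eventually_ge_atTop (2 * v), eventually_ge_atTop 1,
    eventually_const_mul_rpow_le_exp 2 1 (v / 2000) (by norm_num : (0 : ℝ) < 1 / 4000),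
    eventually_const_mul_rpow_le_exp (2 ^ θ * (8000 / distortionRadius) * 2 ^ p) p
      (v * (1 - θ) / 2000) (div_pos (sub_pos.2 hps) (by norm_num : (0 : ℝ) < 4000))]
    with X hXa hXv hX1 hlin hpow
  refine ⟨hXa, by linarith, ?_, ?_⟩
  · rw [hittingBound, ← hv, show (X / 2 - v) / 2000 = 1 / 4000 * X - v / 2000 by ring]
    rw [Real.rpow_one] at hlin
    linarith
  · rw [hittingBound, ← hv, ← hθ, ← Real.exp_mul, Real.mul_rpow (by norm_num) (by linarith)]
    convert hpow using 1
    · ring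
    · congr 1
      ring

/-- The discs with centre `X` and radius `ρ` which serve as nodes of the tree. -/
structure IsNode (g : ℂ → ℂ) (a p s X ρ : ℝ) : Prop where
  isLarge : ∀ Y ≥ X, IsLarge g a p s Y
  le_radius : 80 * (8 / distortionRadius) ^ s * (2 * X) ^ (p * (s - 1)) ≤ ρ
  radius_le : ρ ≤ distortionRadius * X

lemma exists_isNode (g : ℂ → ℂ) (a : ℝ) {p s : ℝ} (hps : p * (s - 1) < 1) :
    ∃ X ρ, IsNode g a p s X ρ := by
  have hκ := distortionRadius_pos
  have hpow : Tendsto (fun X : ℝ => (2 * X) ^ (1 - p * (s - 1))) atTop atTop :=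
    (tendsto_rpow_atTop (by linarith)).comp (tendsto_id.const_mul_atTop (by norm_num))
  obtain ⟨X, hXpow, hlarge, hX0⟩ := ((hpow.eventually_ge_atTop
    (2 / distortionRadius * (80 * (8 / distortionRadius) ^ s))).and
    ((eventually_forall_ge_atTop.2 (eventually_isLarge g a hps)).and
      (eventually_gt_atTop 0))).exists
  refine ⟨X, distortionRadius * X, hlarge, ?_, le_rfl⟩
  calc 80 * (8 / distortionRadius) ^ s * (2 * X) ^ (p * (s - 1))
      = distortionRadius / 2 * ((2 * X) ^ (p * (s - 1)) *
          (2 / distortionRadius * (80 * (8 / distortionRadius) ^ s))) := by field_simp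
    _ ≤ distortionRadius / 2 * ((2 * X) ^ (p * (s - 1)) * (2 * X) ^ (1 - p * (s - 1))) := by
        gcongr
    _ = distortionRadius * X := by
        rw [← Real.rpow_add (by linarith), add_sub_cancel, Real.rpow_one]
        ring

namespace IsNode

variable {g : ℂ → ℂ} {a p s X ρ : ℝ}

lemma two_le_center (h : IsNode g a p s X ρ) (hg : IsTractLog g a p) : 2 ≤ X := by
  linarith [hg.one_le, (h.isLarge X le_rfl).two_mul_le]

lemma one_le_rpow (h : IsNode g a p s X ρ) (hg : IsTractLog g a p) {t : ℝ} (ht : 0 ≤ t) :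
    1 ≤ (2 * X) ^ t :=
  Real.one_le_rpow (by linarith [h.two_le_center hg]) ht

lemma eighty_mul_le_radius (h : IsNode g a p s X ρ) (hg : IsTractLog g a p) (hs : 1 < s) :
    80 * (2 * X) ^ (p * (s - 1)) ≤ ρ := by
  have hκ : 1 ≤ (8 / distortionRadius) ^ s :=
    Real.one_le_rpow ((one_le_div distortionRadius_pos).2 (by linarith [distortionRadius_le]))
      (by linarith)
  have hX := h.two_le_center hg
  calc 80 * (2 * X) ^ (p * (s - 1)) = 80 * 1 * (2 * X) ^ (p * (s - 1)) := by ring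
    _ ≤ 80 * (8 / distortionRadius) ^ s * (2 * X) ^ (p * (s - 1)) := by gcongr
    _ ≤ ρ := h.le_radius

lemma eighty_le_radius (h : IsNode g a p s X ρ) (hg : IsTractLog g a p) (hp : 1 ≤ p)
    (hs : 1 < s) : 80 ≤ ρ := by
  linarith [h.eighty_mul_le_radius hg hs,
    h.one_le_rpow hg (mul_nonneg (by linarith) (by linarith) : 0 ≤ p * (s - 1))]

lemma radius_le_center (h : IsNode g a p s X ρ) (hg : IsTractLog g a p) : ρ ≤ X := by
  nlinarith [h.radius_le, distortionRadius_le, h.two_le_center hg]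

lemma closedBall_subset_distortion (h : IsNode g a p s X ρ) :
    Metric.closedBall (X : ℂ) ρ ⊆ Metric.closedBall (X : ℂ) (distortionRadius * X) :=
  Metric.closedBall_subset_closedBall h.radius_le

lemma closedBall_subset_ball (h : IsNode g a p s X ρ) (hg : IsTractLog g a p) :
    Metric.closedBall (X : ℂ) ρ ⊆ Metric.ball (X : ℂ) (X / 2) :=
  h.closedBall_subset_distortion.trans (hg.closedBall_subset (h.isLarge X le_rfl).two_mul_le)

lemma closedBall_subset_re_gt (h : IsNode g a p s X ρ) (hg : IsTractLog g a p) :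
    Metric.closedBall (X : ℂ) ρ ⊆ {w | a < w.re} :=
  (h.closedBall_subset_ball hg).trans (ball_half_subset_re_gt (h.isLarge X le_rfl).two_mul_le)

lemma exists_steep_points (h : IsNode g a p s X ρ) (hg : IsTractLog g a p) (hp : 1 ≤ p)
    (hρ : 0 < ρ) {M : ℕ} (hM : 0 < M) :
    ∃ J : Finset ℕ, (∀ j ∈ J, j < M) ∧ M ≤ 2 * J.card ∧ ∀ j ∈ J, ∃ x : ℝ,
      (g x).re ∈ Icc (X - ρ / 2 + 2 * j * (ρ / (2 * M)))
        (X - ρ / 2 + (2 * j + 1) * (ρ / (2 * M))) ∧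
      ρ / (4 * (2 * X) ^ p) ≤ ‖deriv g x‖ * x ∧ hittingBound g a X ≤ x := by
  have hX := h.two_le_center hg
  have hρX := h.radius_le_center hg
  have hlarge := h.isLarge X le_rfl
  have hlog0 := hg.log_two_mul_nonneg
  have hlog : Real.log (2 * a) < (2 * X) ^ p := by
    calc Real.log (2 * a) < 2 * a := by
          linarith [Real.log_le_sub_one_of_pos (by linarith [hg.one_le] : 0 < 2 * a)]
      _ ≤ 2 * X := by linarith [hlarge.two_mul_le]
      _ ≤ (2 * X) ^ p := Real.self_le_rpow_of_one_le (by linarith) hp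
  have hstart : (g (Real.exp (Real.log (2 * a)) : ℝ)).re ≤ X - ρ / 2 := by
    rw [Real.exp_log (by linarith [hg.one_le])]
    linarith [hlarge.re_le]
  have hend : X - ρ / 2 + ρ ≤ (g (Real.exp ((2 * X) ^ p) : ℝ)).re := by
    obtain ⟨hpos, hle⟩ := hg.le_re_exp_rpow hlog.le
    linarith [(Real.rpow_le_rpow_iff (by linarith) hpos.le (by linarith)).1 hle]
  obtain ⟨J, hJM, hcard, hJ⟩ := exists_hasDerivAt_steep_on_level
    (v := fun L : ℝ => (g (Real.exp L : ℝ)).re) hlog (fun L hL => hg.hasDerivAt_re hL.1) hρ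
    hstart hend hM
  refine ⟨J, hJM, hcard, fun j hj => ?_⟩
  obtain ⟨L, hL, hlevel, hsteep⟩ := hJ j hj
  refine ⟨Real.exp L, hlevel, ?_, hg.hittingBound_le hL.1 ?_⟩
  · refine (div_le_div_of_nonneg_left hρ.le ?_ ?_).trans
      (hsteep.trans IsTractLog.re_deriv_mul_exp_le) <;> linarith
  · have : 0 ≤ 2 * j * (ρ / (2 * M)) := by positivity
    linarith [hlevel.1]

end IsNode

lemma two_mul_rpow_mul_le {x θ B : ℝ} (hx : 0 < x) (h : 2 ^ θ * B ≤ x ^ (1 - θ)) :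
    (2 * x) ^ θ * B ≤ x := by
  calc (2 * x) ^ θ * B = x ^ θ * (2 ^ θ * B) := by rw [Real.mul_rpow (by norm_num) hx.le]; ring
    _ ≤ x ^ θ * x ^ (1 - θ) := by gcongr
    _ = x := by rw [← Real.rpow_add hx, add_sub_cancel, Real.rpow_one]

namespace IsNode

variable {g : ℂ → ℂ} {a p s X ρ : ℝ}

lemma add_one_le (h : IsNode g a p s X ρ) {x : ℝ} (hx : hittingBound g a X ≤ x) : X + 1 ≤ x :=
  (h.isLarge X le_rfl).add_one_le.trans hx

lemma two_mul_rpow_mul_norm_deriv_le (h : IsNode g a p s X ρ) (hg : IsTractLog g a p)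
    (hps : p * (s - 1) < 1) {x : ℝ} (hx : hittingBound g a X ≤ x) :
    (2 * x) ^ (p * (s - 1)) * ‖deriv g x‖ ≤ distortionRadius / (4 * (2 * X) ^ p) := by
  have hκ := distortionRadius_pos
  have hX := h.two_le_center hg
  have hXx := h.add_one_le hx
  have hlarge := h.isLarge X le_rfl
  have hx0 : 0 < x := by linarith
  have hmul := two_mul_rpow_mul_le hx0 (hlarge.mul_rpow_le.trans
    (Real.rpow_le_rpow (Real.exp_pos _).le hx (sub_pos.2 hps).le))
  have hderiv := hg.norm_deriv_mul_le (hlarge.two_mul_le.trans (by linarith : X ≤ x))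
  rw [le_div_iff₀ (by positivity)]
  refine le_of_mul_le_mul_left ?_ (by positivity : 0 < 2000 / distortionRadius)
  calc 2000 / distortionRadius *
        ((2 * x) ^ (p * (s - 1)) * ‖deriv g x‖ * (4 * (2 * X) ^ p))
      = ‖deriv g x‖ * ((2 * x) ^ (p * (s - 1)) * (8000 / distortionRadius * (2 * X) ^ p)) := by
        ring
    _ ≤ ‖deriv g x‖ * x := by gcongr
    _ ≤ 2000 := hderiv
    _ = 2000 / distortionRadius * distortionRadius := by field_simp

lemma child (h : IsNode g a p s X ρ) (hg : IsTractLog g a p) (hp : 0 ≤ p) (hs : 1 ≤ s)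
    (hps : p * (s - 1) < 1) {x : ℝ} (hx : hittingBound g a X ≤ x) (h0 : deriv g x ≠ 0)
    (hsteep : ρ / (4 * (2 * X) ^ p) ≤ ‖deriv g x‖ * x) :
    IsNode g a p s x (distortionRadius * (ρ / (4 * (2 * X) ^ p) / ‖deriv g x‖)) where
  isLarge Y hY := h.isLarge Y (by linarith [h.add_one_le hx])
  le_radius := by
    have hκ := distortionRadius_pos
    have hX := h.two_le_center hg
    have hD := norm_pos_iff.2 h0
    have hc : 80 * (8 / distortionRadius) ^ s ≤ ρ :=
      (le_mul_of_one_le_right (by positivity)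
        (h.one_le_rpow hg (mul_nonneg hp (sub_nonneg.2 hs)))).trans h.le_radius
    rw [← mul_div_assoc, le_div_iff₀ hD]
    calc 80 * (8 / distortionRadius) ^ s * (2 * x) ^ (p * (s - 1)) * ‖deriv g x‖
        = 80 * (8 / distortionRadius) ^ s * ((2 * x) ^ (p * (s - 1)) * ‖deriv g x‖) := by ring
      _ ≤ ρ * (distortionRadius / (4 * (2 * X) ^ p)) :=
          mul_le_mul hc (h.two_mul_rpow_mul_norm_deriv_le hg hps hx)
            (mul_nonneg (Real.rpow_nonneg (by linarith [h.add_one_le hx]) _) hD.le)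
            ((by positivity : (0 : ℝ) ≤ _).trans hc)
      _ = distortionRadius * (ρ / (4 * (2 * X) ^ p)) := by ring
  radius_le := by
    have hκ := distortionRadius_pos
    gcongr
    rwa [div_le_iff₀' (norm_pos_iff.2 h0)]

end IsNode

lemma exists_enumeration {J : Finset ℕ} (hJ : 0 < J.card) :
    ∃ e : ℕ → ℕ, (∀ j, e j ∈ J) ∧ ∀ i j, i ≤ j → j < J.card → e i + j ≤ e j + i := by
  have hlt (j : ℕ) : min j (J.card - 1) < J.card := by omega
  refine ⟨fun j => J.orderEmbOfFin rfl ⟨min j (J.card - 1), hlt j⟩,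
    fun j => J.orderEmbOfFin_mem rfl _, fun i j hij hj => ?_⟩
  induction j, hij using Nat.le_induction with
  | base => rfl
  | succ j _ ih =>
    have hstep : J.orderEmbOfFin rfl ⟨min j (J.card - 1), hlt j⟩ <
        J.orderEmbOfFin rfl ⟨min (j + 1) (J.card - 1), hlt (j + 1)⟩ := by
      refine (J.orderEmbOfFin rfl).strictMono ?_
      rw [Fin.mk_lt_mk]
      omega
    have hj' := ih (by omega)
    simp only at hj' ⊢
    omega

/-- The children of the node with centre `X` and radius `ρ`. They are arranged in `columns`
columns, the discs in column `j` all having centre `center j` and radius `radius j`; their images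
under the `rows` branches `g + 2πik` with values near `X` have real part close to
`Re g(center j)`, and two columns are at distance at least `separation`. -/
structure ChildGrid (g : ℂ → ℂ) (a p s X ρ : ℝ) where
  columns : ℕ
  rows : ℕ
  center : ℕ → ℝ
  radius : ℕ → ℝ
  separation : ℝ
  columns_pos : 0 < columns
  two_le_rows : 2 ≤ rows
  rows_le : (rows : ℝ) ≤ ρ / 10
  le_columns_mul_rows : (2 * X) ^ p * ρ / 80 ≤ columns * rows
  separation_pos : 0 < separation
  separation_le_one : separation ≤ 1
  le_separation : ρ / (2 * (2 * X) ^ p) ≤ separation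
  isNode : ∀ j, IsNode g a p s (center j) (radius j)
  add_one_le_center : ∀ j, X + 1 ≤ center j
  deriv_ne_zero : ∀ j, deriv g (center j) ≠ 0
  norm_deriv_mul_radius : ∀ j,
    ‖deriv g (center j)‖ * radius j = distortionRadius * (ρ / (4 * (2 * X) ^ p))
  re_mem : ∀ j, (g (center j)).re ∈ Icc (X - ρ / 2) (X + ρ / 2)
  separated : ∀ i j, i ≤ j → j < columns →
    separation * (2 * (j - i) - 1) ≤ (g (center j)).re - (g (center i)).re

namespace IsNode

variable {g : ℂ → ℂ} {a p s X ρ : ℝ}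

lemma exists_children_centers (h : IsNode g a p s X ρ) (hg : IsTractLog g a p) (hp : 1 ≤ p)
    (hρ : 0 < ρ) {M : ℕ} (hM : 0 < M) :
    ∃ (n : ℕ) (x : ℕ → ℝ), 0 < n ∧ M ≤ 2 * n ∧ (∀ j, hittingBound g a X ≤ x j) ∧
      (∀ j, ρ / (4 * (2 * X) ^ p) ≤ ‖deriv g (x j)‖ * x j) ∧
      (∀ j, (g (x j)).re ∈ Icc (X - ρ / 2) (X + ρ / 2)) ∧
      ∀ i j : ℕ, i ≤ j → j < n →
        ρ / (2 * M) * (2 * (j - i) - 1) ≤ (g (x j)).re - (g (x i)).re := by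
  obtain ⟨J, hJM, hcard, hJ⟩ := h.exists_steep_points hg hp hρ hM
  have hcard0 : 0 < J.card := by omega
  obtain ⟨e, heJ, he⟩ := exists_enumeration hcard0
  choose x hlevel hsteep hbound using fun j => hJ (e j) (heJ j)
  refine ⟨J.card, x, hcard0, hcard, hbound, hsteep, fun j => ?_, fun i j hij hj => ?_⟩
  · have hnonneg : 0 ≤ 2 * e j * (ρ / (2 * M)) := by positivity
    have hlt : (e j : ℝ) + 1 ≤ M := by exact_mod_cast hJM _ (heJ j)
    have hle : (2 * (e j : ℝ) + 1) * (ρ / (2 * M)) ≤ 2 * M * (ρ / (2 * M)) := by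
      gcongr
      linarith
    have heq : 2 * M * (ρ / (2 * M)) = ρ := by field_simp
    constructor <;> linarith [(hlevel j).1, (hlevel j).2]
  · have hadd : (e i : ℝ) + j ≤ e j + i := by exact_mod_cast he i j hij hj
    calc ρ / (2 * M) * (2 * (j - i) - 1) ≤ ρ / (2 * M) * (2 * (e j - e i) - 1) :=
          mul_le_mul_of_nonneg_left (by linarith) (by positivity)
      _ = (X - ρ / 2 + 2 * e j * (ρ / (2 * M))) -
          (X - ρ / 2 + (2 * e i + 1) * (ρ / (2 * M))) := by ring
      _ ≤ (g (x j)).re - (g (x i)).re := sub_le_sub (hlevel j).1 (hlevel i).2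

lemma nonempty_childGrid (h : IsNode g a p s X ρ) (hg : IsTractLog g a p) (hp : 1 ≤ p)
    (hs : 1 < s) (hps : p * (s - 1) < 1) : Nonempty (ChildGrid g a p s X ρ) := by
  have hX := h.two_le_center hg
  have hρ := h.eighty_le_radius hg hp hs
  have hΛX : 2 * X ≤ (2 * X) ^ p := Real.self_le_rpow_of_one_le (by linarith) hp
  have hM0 : 0 < ⌊(2 * X) ^ p⌋₊ := Nat.floor_pos.2 (by linarith)
  have hMle : (⌊(2 * X) ^ p⌋₊ : ℝ) ≤ (2 * X) ^ p := Nat.floor_le (by linarith)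
  have hlt := Nat.lt_floor_add_one ((2 * X) ^ p)
  obtain ⟨n, x, hn, hMn, hbound, hsteep, hre, hsep⟩ :=
    h.exists_children_centers hg hp (by linarith) hM0
  set M := ⌊(2 * X) ^ p⌋₊
  have : (0 : ℝ) < M := by exact_mod_cast hM0
  have hMn' : (M : ℝ) ≤ 2 * n := by exact_mod_cast hMn
  have hδ : 0 < ρ / (4 * (2 * X) ^ p) := by positivity
  have hderiv : ∀ j, deriv g (x j) ≠ 0 := fun j h0 => by
    linarith [hsteep j, show ‖deriv g (x j)‖ * x j = 0 by rw [h0, norm_zero, zero_mul]]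
  exact ⟨{
    columns := n
    rows := ⌊ρ / 10⌋₊
    center := x
    radius := fun j => distortionRadius * (ρ / (4 * (2 * X) ^ p) / ‖deriv g (x j)‖)
    separation := ρ / (2 * M)
    columns_pos := hn
    two_le_rows := Nat.le_floor (by push_cast; linarith)
    rows_le := Nat.floor_le (by linarith)
    le_columns_mul_rows := by
      calc (2 * X) ^ p * ρ / 80 = (2 * X) ^ p / 4 * (ρ / 20) := by ring
        _ ≤ n * (⌊ρ / 10⌋₊ : ℝ) := by
          gcongr
          · linarith
          · linarith [Nat.lt_floor_add_one (ρ / 10)]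
    separation_pos := by positivity
    separation_le_one := (div_le_one (by positivity)).2 (by linarith [h.radius_le_center hg])
    le_separation := div_le_div_of_nonneg_left (by linarith) (by positivity) (by linarith)
    isNode := fun j =>
      h.child hg (by linarith) hs.le hps (hbound j) (hderiv j) (hsteep j)
    add_one_le_center := fun j => h.add_one_le (hbound j)
    deriv_ne_zero := hderiv
    norm_deriv_mul_radius := fun j => by
      have := norm_ne_zero_iff.2 (hderiv j)
      field_simp
    re_mem := hre
    separated := hsep }⟩

end IsNode

namespace ChildGrid

variable {g : ℂ → ℂ} {a p s X ρ : ℝ} (C : ChildGrid g a p s X ρ)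

/-- The `i`-th child; the children are numbered column by column. -/
def disc (i : ℕ) : Set ℂ :=
  Metric.closedBall (C.center (i / C.rows) : ℂ) (C.radius (i / C.rows))

/-- The multiple of `2πi` which moves the image of the `i`-th child into the parent disc. -/
noncomputable def shift (i : ℕ) : ℤ :=
  ⌈(-(ρ / 2) - (g (C.center (i / C.rows))).im) / (2 * Real.pi)⌉ + (i % C.rows : ℕ)

/-- The branch `g + 2πik` which maps the `i`-th child into the parent disc; it is cut off outside
the half-plane to be measurable. -/
noncomputable def map (i : ℕ) (w : ℂ) : ℂ :=
  {w : ℂ | a < w.re}.indicator g w + C.shift i * (2 * Real.pi * Complex.I)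

/-- The image of the centre of the `i`-th child. -/
noncomputable def imageCenter (i : ℕ) : ℂ :=
  g (C.center (i / C.rows)) + C.shift i * (2 * Real.pi * Complex.I)

lemma rows_pos : 0 < C.rows := by have := C.two_le_rows; omega

lemma re_imageCenter (i : ℕ) : (C.imageCenter i).re = (g (C.center (i / C.rows))).re := by
  simp [imageCenter]

lemma im_imageCenter (i : ℕ) :
    (C.imageCenter i).im = (g (C.center (i / C.rows))).im + C.shift i * (2 * Real.pi) := by
  simp [imageCenter]

lemma abs_im_imageCenter_le (i : ℕ) : |(C.imageCenter i).im| ≤ ρ / 2 := by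
  rw [im_imageCenter, shift]
  set t := (g (C.center (i / C.rows))).im
  have hπ := Real.pi_pos
  have hle := Int.le_ceil ((-(ρ / 2) - t) / (2 * Real.pi))
  have hlt := (Int.ceil_lt_add_one ((-(ρ / 2) - t) / (2 * Real.pi))).le
  rw [div_le_iff₀ (by positivity)] at hle
  rw [← sub_le_iff_le_add, le_div_iff₀ (by positivity)] at hlt
  have hrow : ((i % C.rows : ℕ) : ℝ) + 1 ≤ ρ / 10 :=
    le_trans (by exact_mod_cast Nat.mod_lt i C.rows_pos) C.rows_le
  have hrow0 : (0 : ℝ) ≤ (i % C.rows : ℕ) := Nat.cast_nonneg _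
  rw [Int.cast_add, Int.cast_natCast, abs_le]
  constructor <;> nlinarith [hrow0, Real.pi_lt_d2]

lemma norm_imageCenter_sub_le (i : ℕ) : ‖C.imageCenter i - X‖ ≤ 3 / 4 * ρ := by
  have hre := C.re_mem (i / C.rows)
  have him := abs_le.1 (C.abs_im_imageCenter_le i)
  rw [← re_imageCenter] at hre
  have hρ : 0 ≤ ρ := by linarith [him.1, him.2]
  rw [← abs_of_nonneg (norm_nonneg _), ← abs_of_nonneg (by positivity : 0 ≤ 3 / 4 * ρ),
    ← sq_le_sq, Complex.sq_norm, Complex.normSq_apply, Complex.sub_re, Complex.sub_im,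
    Complex.ofReal_re, Complex.ofReal_im, sub_zero]
  nlinarith [hre.1, hre.2]

lemma column_separation {i j : ℕ} (hij : i ≤ j) (hj : j < C.columns * C.rows) :
    C.separation * (2 * ((j / C.rows : ℕ) - (i / C.rows : ℕ)) - 1) ≤
      ‖C.imageCenter j - C.imageCenter i‖ := by
  refine le_trans ?_ (Complex.re_le_norm _)
  rw [Complex.sub_re, re_imageCenter, re_imageCenter]
  exact C.separated _ _ (Nat.div_le_div_right hij) ((Nat.div_lt_iff_lt_mul C.rows_pos).2 hj)

lemma row_separation {i j : ℕ} (hij : i / C.rows = j / C.rows) :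
    2 * Real.pi * ((j : ℝ) - i) ≤ ‖C.imageCenter j - C.imageCenter i‖ := by
  have hcast (k : ℕ) : (k : ℝ) = C.rows * (k / C.rows : ℕ) + (k % C.rows : ℕ) := by
    exact_mod_cast (Nat.div_add_mod k C.rows).symm
  refine le_of_eq_of_le ?_ (Complex.im_le_norm _)
  rw [Complex.sub_im, im_imageCenter, im_imageCenter, shift, shift, hij, hcast i, hcast j, hij]
  simp only [Int.cast_add, Int.cast_natCast]
  ring

lemma separation_le {i j : ℕ} (hi : i < C.columns * C.rows) (hj : j < C.columns * C.rows)
    (hij : i ≠ j) : C.separation ≤ ‖C.imageCenter i - C.imageCenter j‖ := by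
  wlog hlt : i < j generalizing i j
  · rw [norm_sub_rev]
    exact this hj hi hij.symm (by omega)
  rw [norm_sub_rev]
  rcases (Nat.div_le_div_right hlt.le : i / C.rows ≤ j / C.rows).lt_or_eq with h | h
  · have hcast : ((i / C.rows : ℕ) : ℝ) + 1 ≤ (j / C.rows : ℕ) := by exact_mod_cast h
    nlinarith [C.column_separation hlt.le hj, C.separation_pos]
  · have hcast : (i : ℝ) + 1 ≤ j := by exact_mod_cast hlt
    nlinarith [C.row_separation h, C.separation_le_one, Real.pi_gt_three]

section Counting

variable {F : Finset ℕ} {t : ℝ}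

lemma card_filter_column_le (ht : 0 ≤ t)
    (hF : ∀ i ∈ F, ∀ j ∈ F, ‖C.imageCenter i - C.imageCenter j‖ ≤ t) (c : ℕ) :
    ((F.filter fun i => i / C.rows = c).card : ℝ) ≤ t + 1 := by
  refine card_le_of_forall_sub_le ht fun i hi j hj => ?_
  rw [Finset.mem_filter] at hi hj
  have hrow := (C.row_separation (hi.2.trans hj.2.symm)).trans (hF j hj.1 i hi.1)
  by_contra! hlt
  nlinarith [Real.pi_gt_three]

lemma card_image_column_le (ht : 0 ≤ t) (hlt : ∀ i ∈ F, i < C.columns * C.rows)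
    (hF : ∀ i ∈ F, ∀ j ∈ F, ‖C.imageCenter i - C.imageCenter j‖ ≤ t) :
    ((F.image (· / C.rows)).card : ℝ) ≤ (t / C.separation + 1) / 2 + 1 := by
  have hsep := C.separation_pos
  have hquot : 0 ≤ t / C.separation := by positivity
  refine card_le_of_forall_sub_le (by positivity) fun k hk l hl => ?_
  obtain ⟨i, hi, rfl⟩ := Finset.mem_image.1 hk
  obtain ⟨j, hj, rfl⟩ := Finset.mem_image.1 hl
  rcases le_total i j with hij | hij
  · have hcol := (C.column_separation hij (hlt j hj)).trans (hF j hj i hi)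
    rw [← le_div_iff₀' hsep] at hcol
    linarith
  · have hcast : ((j / C.rows : ℕ) : ℝ) ≤ (i / C.rows : ℕ) := by
      exact_mod_cast Nat.div_le_div_right hij
    linarith

lemma card_le_of_norm_imageCenter_sub_le (ht : 0 ≤ t) (hlt : ∀ i ∈ F, i < C.columns * C.rows)
    (hF : ∀ i ∈ F, ∀ j ∈ F, ‖C.imageCenter i - C.imageCenter j‖ ≤ t) :
    (F.card : ℝ) ≤ (t + 1) * ((t / C.separation + 1) / 2 + 1) := by
  have hcard : F.card ≤ ⌊t + 1⌋₊ * (F.image (· / C.rows)).card :=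
    Finset.card_le_mul_card_image F _ fun c _ => Nat.le_floor (C.card_filter_column_le ht hF c)
  calc (F.card : ℝ) ≤ ⌊t + 1⌋₊ * ((F.image (· / C.rows)).card : ℝ) := by exact_mod_cast hcard
    _ ≤ (t + 1) * ((t / C.separation + 1) / 2 + 1) := by
        gcongr
        · exact Nat.floor_le (by linarith)
        · exact C.card_image_column_le ht hlt hF

end Counting

variable {C}

lemma measurable_map (hg : IsTractLog g a p) (i : ℕ) : Measurable (C.map i) := by
  classical
  refine Measurable.add_const ?_ _
  rw [← piecewise_eq_indicator]
  exact hg.differentiableOn.continuousOn.measurable_piecewise continuousOn_const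
    (isOpen_re_gt a).measurableSet

lemma exp_map (i : ℕ) {w : ℂ} (hw : a < w.re) :
    Complex.exp (C.map i w) = Complex.exp (g w) := by
  rw [map, indicator_of_mem (show w ∈ {w : ℂ | a < w.re} from hw)]
  exact Complex.exp_periodic.int_mul _ _

variable {i : ℕ} {w w' : ℂ}

lemma map_sub_map (hg : IsTractLog g a p) (hw : w ∈ C.disc i) (hw' : w' ∈ C.disc i) :
    C.map i w - C.map i w' = g w - g w' := by
  rw [map, map, indicator_of_mem ((C.isNode _).closedBall_subset_re_gt hg hw),
    indicator_of_mem ((C.isNode _).closedBall_subset_re_gt hg hw'), add_sub_add_right_eq_sub]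

lemma norm_map_sub_le (hg : IsTractLog g a p) (hw : w ∈ C.disc i) (hw' : w' ∈ C.disc i) :
    ‖C.map i w - C.map i w'‖ ≤ 3 / 2 * ‖deriv g (C.center (i / C.rows))‖ * ‖w - w'‖ := by
  have h := C.isNode (i / C.rows)
  rw [map_sub_map hg hw hw']
  exact hg.norm_sub_le (h.isLarge _ le_rfl).two_mul_le (C.deriv_ne_zero _)
    (h.closedBall_subset_distortion hw) (h.closedBall_subset_distortion hw')

lemma le_norm_map_sub (hg : IsTractLog g a p) (hw : w ∈ C.disc i) (hw' : w' ∈ C.disc i) :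
    1 / 2 * ‖deriv g (C.center (i / C.rows))‖ * ‖w - w'‖ ≤ ‖C.map i w - C.map i w'‖ := by
  have h := C.isNode (i / C.rows)
  rw [map_sub_map hg hw hw']
  exact hg.le_norm_sub (h.isLarge _ le_rfl).two_mul_le (C.deriv_ne_zero _)
    (h.closedBall_subset_distortion hw) (h.closedBall_subset_distortion hw')

lemma norm_deriv_mul_radius_le (j : ℕ) :
    3 / 2 * ‖deriv g (C.center j)‖ * C.radius j ≤ C.separation / 8 := by
  have hsep := C.le_separation
  rw [show ρ / (2 * (2 * X) ^ p) = 2 * (ρ / (4 * (2 * X) ^ p)) by ring] at hsep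
  rw [mul_assoc, C.norm_deriv_mul_radius]
  nlinarith [distortionRadius_le, distortionRadius_pos, C.separation_pos]

lemma norm_map_sub_imageCenter_le (hg : IsTractLog g a p) (hw : w ∈ C.disc i) :
    ‖C.map i w - C.imageCenter i‖ ≤ C.separation / 8 := by
  have hself : (C.center (i / C.rows) : ℂ) ∈ C.disc i :=
    Metric.mem_closedBall_self (Metric.nonempty_closedBall.1 ⟨w, hw⟩)
  have hcenter : C.imageCenter i = C.map i (C.center (i / C.rows)) := by
    rw [map, indicator_of_mem ((C.isNode _).closedBall_subset_re_gt hg hself), imageCenter]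
  rw [hcenter]
  refine (norm_map_sub_le hg hw hself).trans (le_trans ?_ (norm_deriv_mul_radius_le (i / C.rows)))
  gcongr
  exact mem_closedBall_iff_norm.1 hw

lemma mapsTo_map (h : IsNode g a p s X ρ) (hg : IsTractLog g a p) (hp : 1 ≤ p) (hs : 1 < s)
    (i : ℕ) : MapsTo (C.map i) (C.disc i) (Metric.closedBall (X : ℂ) ρ) := by
  intro w hw
  rw [mem_closedBall_iff_norm]
  linarith [norm_sub_le_norm_sub_add_norm_sub (C.map i w) (C.imageCenter i) X,
    norm_map_sub_imageCenter_le hg hw, C.norm_imageCenter_sub_le i, C.separation_le_one,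
    h.eighty_le_radius hg hp hs]

end ChildGrid

lemma sq_le_two_mul_rpow {b s : ℝ} (hb : 0 < b) (hb2 : b ≤ 2) (hs1 : 1 ≤ s) (hs2 : s ≤ 2) :
    b ^ 2 ≤ 2 * b ^ s := by
  calc b ^ 2 = b ^ (2 - s) * b ^ s := by
        rw [← Real.rpow_add hb, sub_add_cancel, Real.rpow_two]
    _ ≤ 2 ^ (2 - s) * b ^ s := by gcongr
    _ ≤ 2 ^ (1 : ℝ) * b ^ s := by gcongr <;> linarith
    _ = 2 * b ^ s := by rw [Real.rpow_one]

lemma twenty_mul_le_mul_rpow {Λ ρ s b : ℝ} (hΛ : 0 < Λ) (hs1 : 1 ≤ s) (hs2 : s ≤ 2)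
    (h : 80 * Λ ^ (s - 1) ≤ ρ) (hb : 0 < b) (hΛb : 1 ≤ 4 * Λ * b) : 20 * b ≤ ρ * b ^ s := by
  have hb1 : 20 ≤ ρ * b ^ (s - 1) := by
    calc 20 ≤ 20 * (4 * Λ * b) ^ (s - 1) :=
          le_mul_of_one_le_right (by norm_num) (Real.one_le_rpow hΛb (by linarith))
      _ = 20 * (4 ^ (s - 1) * Λ ^ (s - 1) * b ^ (s - 1)) := by
          rw [Real.mul_rpow (by positivity) hb.le, Real.mul_rpow (by norm_num) hΛ.le]
      _ ≤ 20 * (4 ^ (1 : ℝ) * Λ ^ (s - 1) * b ^ (s - 1)) := by gcongr <;> linarith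
      _ = 80 * Λ ^ (s - 1) * b ^ (s - 1) := by rw [Real.rpow_one]; ring
      _ ≤ ρ * b ^ (s - 1) := by gcongr
  calc 20 * b ≤ ρ * b ^ (s - 1) * b := by gcongr
    _ = ρ * b ^ s := by rw [mul_assoc, ← Real.rpow_add_one' hb.le (by linarith), sub_add_cancel]

lemma mul_mul_rpow_le {Λ ρ s N d r : ℝ} (hΛ : 0 < Λ) (hρ : 0 < ρ) (hs1 : 1 < s) (hs2 : s ≤ 2)
    (h : 80 * Λ ^ (s - 1) ≤ ρ) (hN : Λ * ρ / 80 ≤ N) (hd : 0 < d) (hρd : ρ / (2 * Λ) ≤ d)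
    (hdr : d / 2 ≤ r) (hr : r ≤ 2 * ρ) :
    (r / d + 2) * (r + 2) * (ρ ^ s / 3200) ≤ N * r ^ s := by
  obtain ⟨b, rfl⟩ : ∃ b, r = ρ * b := ⟨r / ρ, by field_simp⟩
  have hr0 : 0 < ρ * b := by linarith
  have hb : 0 < b := pos_of_mul_pos_right hr0 hρ.le
  rw [div_le_iff₀ (by positivity)] at hρd
  have hcolumns : ρ * b / d + 2 ≤ 10 * Λ * b := by
    rw [div_add' _ _ _ hd.ne', div_le_iff₀ hd]
    nlinarith
  have hrows : b * (ρ * b + 2) ≤ 4 * ρ * b ^ s := by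
    have hsq := sq_le_two_mul_rpow hb (by nlinarith) hs1.le hs2
    have hlin := twenty_mul_le_mul_rpow hΛ hs1.le hs2 h hb (by nlinarith)
    nlinarith
  calc (ρ * b / d + 2) * (ρ * b + 2) * (ρ ^ s / 3200)
      ≤ 10 * Λ * b * (ρ * b + 2) * (ρ ^ s / 3200) := by gcongr
    _ = 10 * Λ * (b * (ρ * b + 2)) * (ρ ^ s / 3200) := by ring
    _ ≤ 10 * Λ * (4 * ρ * b ^ s) * (ρ ^ s / 3200) := by gcongr
    _ = Λ * ρ / 80 * (ρ * b) ^ s := by rw [Real.mul_rpow hρ.le hb.le]; ring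
    _ ≤ N * (ρ * b) ^ s := by gcongr

lemma rpow_le_mul_rpow {κ Λ ρ s N : ℝ} (hκ : 0 < κ) (hΛ : 0 < Λ) (hρ : 0 < ρ)
    (h : 80 * (8 / κ) ^ s * Λ ^ (s - 1) ≤ ρ) (hN : Λ * ρ / 80 ≤ N) :
    ρ ^ s ≤ N * (κ * (ρ / (8 * Λ))) ^ s := by
  have hfrac : κ * (ρ / (8 * Λ)) = ρ / (8 / κ * Λ) := by field_simp
  rw [hfrac, Real.div_rpow hρ.le (by positivity), Real.mul_rpow (by positivity) hΛ.le,
    ← mul_div_assoc, le_div_iff₀ (by positivity), mul_comm]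
  gcongr
  calc (8 / κ) ^ s * Λ ^ s = Λ * (80 * (8 / κ) ^ s * Λ ^ (s - 1)) / 80 := by
        rw [Real.rpow_sub_one hΛ.ne']
        field_simp
    _ ≤ Λ * ρ / 80 := by gcongr
    _ ≤ N := hN

namespace ChildGrid

variable {g : ℂ → ℂ} {a p s X ρ : ℝ} {C : ChildGrid g a p s X ρ}

lemma norm_imageCenter_sub_imageCenter_le (hg : IsTractLog g a p) {i j : ℕ} {w w' : ℂ}
    (hw : w ∈ C.disc i) (hw' : w' ∈ C.disc j) :
    ‖C.imageCenter i - C.imageCenter j‖ ≤ ‖C.map i w - C.map j w'‖ + C.separation / 4 := by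
  have hi := norm_map_sub_imageCenter_le hg hw
  have hj := norm_map_sub_imageCenter_le hg hw'
  rw [norm_sub_rev] at hi
  linarith [norm_sub_le_norm_sub_add_norm_sub (C.imageCenter i) (C.map i w) (C.imageCenter j),
    norm_sub_le_norm_sub_add_norm_sub (C.map i w) (C.map j w') (C.imageCenter j)]

lemma card_le_of_norm_map_sub_le {F : Finset ℕ} {r : ℝ}
    (hlt : ∀ i ∈ F, i < C.columns * C.rows) (hF2 : 2 ≤ F.card)
    (hF : ∀ i ∈ F, ∀ j ∈ F,
      ‖C.imageCenter i - C.imageCenter j‖ ≤ r + C.separation / 4) :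
    C.separation / 2 ≤ r ∧ (F.card : ℝ) ≤ (r / C.separation + 2) * (r + 2) := by
  have hsep := C.separation_pos
  obtain ⟨i, hi, j, hj, hij⟩ := Finset.one_lt_card.1 (by omega : 1 < F.card)
  have hr : C.separation / 2 ≤ r := by
    linarith [C.separation_le (hlt i hi) (hlt j hj) hij, hF i hi j hj]
  have hr0 : 0 ≤ r := by linarith
  refine ⟨hr, (C.card_le_of_norm_imageCenter_sub_le (by linarith) hlt hF).trans ?_⟩
  have hdiv : (r + C.separation / 4) / C.separation = r / C.separation + 1 / 4 := by field_simp
  have hquot : 0 ≤ r / C.separation := by positivity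
  rw [hdiv, mul_comm]
  apply mul_le_mul <;> linarith [C.separation_le_one]

lemma card_mul_le_mul_rpow (h : IsNode g a p s X ρ) (hg : IsTractLog g a p) (hp : 1 ≤ p)
    (hs : 1 < s) (hs2 : s ≤ 2) {F : Finset ℕ} {r : ℝ} (hlt : ∀ i ∈ F, i < C.columns * C.rows)
    (hF2 : 2 ≤ F.card)
    (hF : ∀ i ∈ F, ∀ j ∈ F, ∃ w ∈ C.disc i, ∃ w' ∈ C.disc j, ‖C.map i w - C.map j w'‖ ≤ r) :
    F.card * (ρ ^ s / 3200) ≤ C.columns * C.rows * r ^ s := by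
  have hX := h.two_le_center hg
  have hρ := h.eighty_le_radius hg hp hs
  have hsep := C.separation_pos
  obtain ⟨hr, hcard⟩ := C.card_le_of_norm_map_sub_le (r := min r (2 * ρ)) hlt hF2 (by
    intro i hi j hj
    obtain ⟨w, hw, w', hw', hww⟩ := hF i hi j hj
    have hdiam : ‖C.map i w - C.map j w'‖ ≤ 2 * ρ := by
      rw [← dist_eq_norm, two_mul]
      exact (dist_triangle_right _ _ (X : ℂ)).trans
        (add_le_add (mapsTo_map h hg hp hs i hw) (mapsTo_map h hg hp hs j hw'))
    linarith [norm_imageCenter_sub_imageCenter_le hg hw hw', le_min hww hdiam])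
  have hpow : 80 * ((2 * X) ^ p) ^ (s - 1) ≤ ρ := by
    rw [← Real.rpow_mul (by linarith)]
    exact h.eighty_mul_le_radius hg hs
  have hr0 : 0 ≤ min r (2 * ρ) := by linarith
  calc F.card * (ρ ^ s / 3200)
      ≤ (min r (2 * ρ) / C.separation + 2) * (min r (2 * ρ) + 2) * (ρ ^ s / 3200) := by gcongr
    _ ≤ C.columns * C.rows * min r (2 * ρ) ^ s :=
        mul_mul_rpow_le (by positivity) (by linarith) hs hs2 hpow C.le_columns_mul_rows hsep
          C.le_separation hr (min_le_right _ _)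
    _ ≤ C.columns * C.rows * r ^ s := by
        gcongr
        exact min_le_left _ _

lemma rpow_le_mul_mul_rpow (h : IsNode g a p s X ρ) (hg : IsTractLog g a p) (hp : 1 ≤ p)
    (hs : 1 < s) (j : ℕ) :
    ρ ^ s ≤ C.columns * C.rows *
      ((1 / 2 * ‖deriv g (C.center j)‖) ^ s * C.radius j ^ s) := by
  have hX := h.two_le_center hg
  have hρ := h.eighty_le_radius hg hp hs
  have hradius := (C.isNode j).eighty_le_radius hg hp hs
  have hmul : 1 / 2 * ‖deriv g (C.center j)‖ * C.radius j =
      distortionRadius * (ρ / (8 * (2 * X) ^ p)) := by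
    rw [mul_assoc, C.norm_deriv_mul_radius]
    ring
  rw [← Real.mul_rpow (by positivity) (by linarith), hmul]
  refine rpow_le_mul_rpow distortionRadius_pos (by positivity) (by linarith) ?_
    C.le_columns_mul_rows
  rw [← Real.rpow_mul (by linarith)]
  exact h.le_radius

end ChildGrid

/-! ### Escaping orbits -/

/-- The nodes of the tree: the pairs of centre and radius. -/
abbrev Node (g : ℂ → ℂ) (a p s : ℝ) : Type := {x : ℝ × ℝ // IsNode g a p s x.1 x.2}

/-- The tree of discs in which the children of every node form the given grid. -/
noncomputable def gridTree {g : ℂ → ℂ} {a p s : ℝ} (hg : IsTractLog g a p) (hp : 1 ≤ p)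
    (hs : 1 < s) (C : ∀ σ : Node g a p s, ChildGrid g a p s σ.1.1 σ.1.2) :
    BallTree (Node g a p s) ℂ where
  center σ := (σ.1.1 : ℂ)
  radius σ := σ.1.2
  num σ := (C σ).columns * (C σ).rows
  child σ i := ⟨((C σ).center (i / (C σ).rows), (C σ).radius (i / (C σ).rows)), (C σ).isNode _⟩
  map σ i := (C σ).map i
  radius_pos σ := by linarith [σ.2.eighty_le_radius hg hp hs]
  two_le_num σ := (C σ).two_le_rows.trans (Nat.le_mul_of_pos_left _ (C σ).columns_pos)
  measurable_map σ i := ChildGrid.measurable_map hg i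
  mapsTo σ i _ := ChildGrid.mapsTo_map σ.2 hg hp hs i
  lipschitz σ i _ := by
    refine ⟨3 / 2 * ‖deriv g ((C σ).center (i / (C σ).rows))‖₊, ?_, ?_⟩
    · exact ((C σ).norm_deriv_mul_radius_le _).trans
        (by linarith [(C σ).separation_le_one, σ.2.eighty_le_radius hg hp hs])
    · exact LipschitzOnWith.of_dist_le_mul fun w hw w' hw' => by
        simpa [dist_eq_norm] using ChildGrid.norm_map_sub_le hg hw hw'

/-- The starting points of the escaping orbits of `(exp ∘ g)⁻¹ ∘ exp`, which is a lift of `f` under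
`exp` if `f ∘ exp ∘ g = exp`. -/
def logEscapingSet (g : ℂ → ℂ) (a : ℝ) : Set ℂ :=
  {z | ∃ w : ℕ → ℂ, w 0 = z ∧
    (∀ n, a < (w n).re ∧ Complex.exp (w n) = Complex.exp (g (w (n + 1)))) ∧
    Tendsto (fun n => (w n).re) atTop atTop}

section gridTree

variable {g : ℂ → ℂ} {a p s : ℝ} {hg : IsTractLog g a p} {hp : 1 ≤ p} {hs : 1 < s}
  {C : ∀ σ : Node g a p s, ChildGrid g a p s σ.1.1 σ.1.2}

lemma isMassDistribution_gridTree (hs2 : s ≤ 2) :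
    (gridTree hg hp hs C).IsMassDistribution s
      (fun σ i => 1 / 2 * ‖deriv g ((C σ).center (i / (C σ).rows))‖)
      (fun σ => σ.1.2 ^ s / 3200) where
  weight_pos σ := by
    have := σ.2.eighty_le_radius hg hp hs
    positivity
  contraction_pos σ i _ := by
    have := norm_pos_iff.2 ((C σ).deriv_ne_zero (i / (C σ).rows))
    positivity
  mul_dist_le σ i _ w hw w' hw' := by
    rw [dist_eq_norm, dist_eq_norm]
    exact ChildGrid.le_norm_map_sub hg hw hw'
  mass_le σ i _ := by
    have hle := ChildGrid.rpow_le_mul_mul_rpow (C := C σ) σ.2 hg hp hs (i / (C σ).rows)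
    change σ.1.2 ^ s / 3200 ≤ (((C σ).columns * (C σ).rows : ℕ) : ℝ) * _ *
      ((C σ).radius (i / (C σ).rows) ^ s / 3200)
    push_cast
    linarith
  card_mul_le σ F r hlt hF2 hF := by
    change _ ≤ (((C σ).columns * (C σ).rows : ℕ) : ℝ) * r ^ s
    push_cast
    refine ChildGrid.card_mul_le_mul_rpow σ.2 hg hp hs hs2 hlt hF2 fun i hi j hj => ?_
    obtain ⟨w, hw, w', hw', hww⟩ := hF i hi j hj
    exact ⟨w, hw, w', hw', (dist_eq_norm _ _).symm.trans_le hww⟩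

lemma limitSet_gridTree_subset (σ : Node g a p s) :
    (gridTree hg hp hs C).limitSet σ ⊆ logEscapingSet g a := by
  rintro z ⟨τ, i, w, -, hw0, hw⟩
  have hre (n : ℕ) : a < (w n).re := (τ n).2.closedBall_subset_re_gt hg (hw n).2.2.1
  refine ⟨w, hw0, fun n => ⟨hre n, ?_⟩, ?_⟩
  · rw [(hw n).2.2.2]
    exact ChildGrid.exp_map (i n) (hre (n + 1))
  have hcenter (n : ℕ) : (n : ℝ) ≤ (τ n).1.1 := by
    induction n with
    | zero => simpa using (by linarith [(τ 0).2.two_le_center hg] : (0 : ℝ) ≤ (τ 0).1.1)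
    | succ n ih =>
      rw [(hw n).2.1, Nat.cast_succ]
      exact (add_le_add_left ih 1).trans ((C (τ n)).add_one_le_center _)
  refine tendsto_atTop_mono (fun n => ?_)
    (tendsto_natCast_atTop_atTop.atTop_div_const (by norm_num : (0 : ℝ) < 2))
  have hball := mem_ball_iff_norm'.1 ((τ n).2.closedBall_subset_ball hg (hw n).2.2.1)
  have hsub := (Complex.re_le_norm _).trans hball.le
  rw [Complex.sub_re, Complex.ofReal_re] at hsub
  linarith [hcenter n]

end gridTree

theorem IsTractLog.le_dimH_logEscapingSet {g : ℂ → ℂ} {a p s : ℝ} (hg : IsTractLog g a p)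
    (hp : 1 ≤ p) (hs : 1 < s) (hps : p * (s - 1) < 1) :
    ENNReal.ofReal s ≤ dimH (logEscapingSet g a) := by
  obtain ⟨X, ρ, hX⟩ := exists_isNode g a hps
  let C (σ : Node g a p s) := (σ.2.nonempty_childGrid hg hp hs hps).some
  have hT : (gridTree hg hp hs C).IsMassDistribution s _ _ :=
    isMassDistribution_gridTree (by nlinarith)
  exact (hT.le_dimH_limitSet (by linarith) ⟨(X, ρ), hX⟩).trans
    (dimH_mono (limitSet_gridTree_subset _))

lemma dimH_le_dimH_image_of_hasStrictFDerivAt {𝕜 E F : Type*} [NontriviallyNormedField 𝕜]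
    [NormedAddCommGroup E] [NormedSpace 𝕜 E] [CompleteSpace E] [SecondCountableTopology E]
    [NormedAddCommGroup F] [NormedSpace 𝕜 F] {f : E → F} {f' : E → E ≃L[𝕜] F} {K : Set E}
    (hf : ∀ x ∈ K, HasStrictFDerivAt f (f' x : E →L[𝕜] F) x) : dimH K ≤ dimH (f '' K) := by
  by_contra! hlt
  obtain ⟨x, hx, hloc⟩ := exists_mem_nhdsWithin_lt_dimH_of_lt_dimH hlt
  obtain ⟨L, t, ht, hL⟩ := (hf x hx).to_localInverse.exists_lipschitzOnWith
  set u := {y ∈ K | (hf x hx).localInverse f (f' x) x (f y) = y ∧ f y ∈ t}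
  have hu : u ∈ 𝓝[K] x := by
    filter_upwards [self_mem_nhdsWithin, nhdsWithin_le_nhds (hf x hx).eventually_left_inverse,
      nhdsWithin_le_nhds ((hf x hx).continuousAt ht)] with y hy hinv hyt
    exact ⟨hy, hinv, hyt⟩
  have hle : dimH u ≤ dimH (f '' K) := by
    calc dimH u ≤ dimH ((hf x hx).localInverse f (f' x) x '' (f '' u)) :=
          dimH_mono fun y hy => ⟨f y, mem_image_of_mem f hy, hy.2.1⟩
      _ ≤ dimH (f '' u) := (hL.mono (image_subset_iff.2 fun y hy => hy.2.2)).dimH_image_le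
      _ ≤ dimH (f '' K) := dimH_mono (image_mono fun y hy => hy.1)
  exact (hloc u hu).not_ge hle

lemma dimH_le_dimH_image_exp (K : Set ℂ) : dimH K ≤ dimH (Complex.exp '' K) :=
  dimH_le_dimH_image_of_hasStrictFDerivAt fun w _ =>
    (Complex.hasStrictDerivAt_exp w).hasStrictFDerivAt_equiv (Complex.exp_ne_zero w)

lemma image_exp_logEscapingSet_subset {f g : ℂ → ℂ} {D : Set ℂ} {a : ℝ}
    (hg : ∀ w : ℂ, a < w.re →
      Complex.exp (g w) ∈ D ∧ f (Complex.exp (g w)) = Complex.exp w) :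
    Complex.exp '' logEscapingSet g a ⊆ escapingSetIn f D := by
  rintro _ ⟨_, ⟨w, rfl, hw, hlim⟩, rfl⟩
  have hiter (n : ℕ) : f^[n] (Complex.exp (w 0)) = Complex.exp (w n) := by
    induction n with
    | zero => rfl
    | succ n ih => rw [Function.iterate_succ_apply', ih, (hw n).2, (hg _ (hw (n + 1)).1).2]
  have hD (n : ℕ) : Complex.exp (w n) ∈ D := by
    rw [(hw n).2]
    exact (hg _ (hw (n + 1)).1).1
  refine ⟨hD 0, fun n => by rw [hiter]; exact hD n, ?_⟩
  simp only [hiter, Complex.norm_exp]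
  exact Real.tendsto_exp_atTop.comp hlim

lemma exists_isTractLog {f : ℂ → ℂ} {D : Set ℂ} {R p r : ℝ} (hD : IsOpen D)
    (hf : DifferentiableOn ℂ f D) (hbdd : ∀ ρ : ℝ, ∃ M, ∀ z ∈ D, ‖z‖ ≤ ρ → ‖f z‖ ≤ M)
    (hR : 0 < R) (hcov : IsUniversalCoveringOnto f D {w | R < ‖w‖})
    (hr : ∀ z ∈ D, r ≤ ‖z‖ → ‖f z‖ ≤ Real.exp (Real.exp (Real.log ‖z‖ ^ p))) :
    ∃ (a : ℝ) (g : ℂ → ℂ), IsTractLog g a p ∧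
      ∀ w : ℂ, a < w.re → Complex.exp (g w) ∈ D ∧ f (Complex.exp (g w)) = Complex.exp w := by
  obtain ⟨a, g, hgd, hgi, hg⟩ := exists_log_coordinate hD hf hbdd hR hcov hr
  have hsub : {w : ℂ | max a 1 < w.re} ⊆ {w | a < w.re} := fun w hw =>
    (le_max_left a 1).trans_lt (show max a 1 < w.re from hw)
  exact ⟨max a 1, g, ⟨le_max_right _ _, hgd.mono hsub, hgi.mono hsub,
    fun w hw => (hg w (hsub hw)).2.2⟩, fun w hw => ⟨(hg w (hsub hw)).1, (hg w (hsub hw)).2.1⟩⟩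

lemma ofReal_one_add_one_div_le {q : ℝ} (hq : 0 < q) {d : ENNReal}
    (h : ∀ s : ℝ, 1 < s → q * (s - 1) < 1 → ENNReal.ofReal s ≤ d) :
    ENNReal.ofReal (1 + 1 / q) ≤ d := by
  refine le_of_tendsto ((ENNReal.continuous_ofReal.tendsto (1 + 1 / q)).mono_left
    (nhdsWithin_le_nhds (s := Iio (1 + 1 / q)))) ?_
  filter_upwards [Ioo_mem_nhdsLT (lt_add_of_pos_right 1 (one_div_pos.2 hq))] with s hs
  exact h s hs.1 ((lt_div_iff₀' hq).1 (sub_lt_iff_lt_add'.2 hs.2))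

theorem theorem2_general {f : ℂ → ℂ} {D : Set ℂ} {q R : ℝ} (hD : IsOpen D)
    (hf : DifferentiableOn ℂ f D) (hbdd : ∀ ρ : ℝ, ∃ M, ∀ z ∈ D, ‖z‖ ≤ ρ → ‖f z‖ ≤ M)
    (hR : 0 < R) (hcov : IsUniversalCoveringOnto f D {w | R < ‖w‖})
    (hgrowth : ∀ ε : ℝ, 0 < ε → ∃ r : ℝ, ∀ z ∈ D, r ≤ ‖z‖ →
      ‖f z‖ ≤ Real.exp (Real.exp (Real.log ‖z‖ ^ (q + ε)))) :
    ENNReal.ofReal (1 + 1 / q) ≤ dimH (escapingSetIn f D) := by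
  have htract : ∀ p > q, ∃ (a : ℝ) (g : ℂ → ℂ), IsTractLog g a p ∧
      ∀ w : ℂ, a < w.re → Complex.exp (g w) ∈ D ∧ f (Complex.exp (g w)) = Complex.exp w := by
    intro p hp
    obtain ⟨r, hr⟩ := hgrowth (p - q) (sub_pos.2 hp)
    exact exists_isTractLog hD hf hbdd hR hcov (by rwa [add_sub_cancel] at hr)
  have hq : 1 ≤ q := by
    by_contra! hq
    obtain ⟨p, hp, hp1⟩ := exists_between (max_lt hq one_pos)
    obtain ⟨a, g, hg, -⟩ := htract p ((le_max_left _ _).trans_lt hp)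
    linarith [hg.one_le_exponent ((le_max_right _ _).trans_lt hp)]
  refine ofReal_one_add_one_div_le (by linarith) fun s hs hqs => ?_
  obtain ⟨p, hqp, hps⟩ := exists_between ((lt_div_iff₀ (sub_pos.2 hs)).2 hqs)
  obtain ⟨a, g, hg, hgD⟩ := htract p hqp
  calc ENNReal.ofReal s ≤ dimH (logEscapingSet g a) :=
        hg.le_dimH_logEscapingSet (by linarith) hs ((lt_div_iff₀ (sub_pos.2 hs)).1 hps)
    _ ≤ dimH (Complex.exp '' logEscapingSet g a) := dimH_le_dimH_image_exp _
    _ ≤ dimH (escapingSetIn f D) := dimH_mono (image_exp_logEscapingSet_subset hgD)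

lemma exists_norm_le_of_continuousOn_closure {f : ℂ → ℂ} {D : Set ℂ}
    (hf : ContinuousOn f (closure D)) (ρ : ℝ) : ∃ M, ∀ z ∈ D, ‖z‖ ≤ ρ → ‖f z‖ ≤ M := by
  obtain ⟨M, hM⟩ := ((isCompact_closedBall (0 : ℂ) ρ).inter_left
    isClosed_closure).exists_bound_of_continuousOn (hf.mono inter_subset_left)
  exact ⟨M, fun z hz hzρ => hM z ⟨subset_closure hz, mem_closedBall_zero_iff.2 hzρ⟩⟩

theorem theorem2 (f : ℂ → ℂ) (D : Set ℂ) (q : ℝ) (hD : IsLogarithmicTract f D)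
    (hgrowth : ∀ ε : ℝ, 0 < ε → ∃ r : ℝ, 0 < r ∧ ∀ z ∈ D, r ≤ ‖z‖ →
      ‖f z‖ ≤ Real.exp (Real.exp (Real.log ‖z‖ ^ (q + ε)))) :
    ENNReal.ofReal (1 + 1 / q) ≤ dimH (escapingSetIn f D) := by
  obtain ⟨R, hR, hcov⟩ := hD.covering
  exact theorem2_general hD.isOpen hD.holomorphic
    (exists_norm_le_of_continuousOn_closure hD.continuousOn) hR hcov
    fun ε hε => (hgrowth ε hε).imp fun _ hr => hr.2
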